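/- Let $d\ge 3$ and $n\ge 1$ be integers. To every source $(0,z)$, $z\in\mathbb{Z}^{d-1}$, of the hyperplane $\{0\}\times\mathbb{Z}^{d-1}\subset\mathbb{Z}^d$ attach $n$ simple symmetric random walks $S_{z,1},\dots,S_{z,n}$ on $\mathbb{Z}^d$ started at $(0,z)$, all these walks being independent. Given a finite set $A\subset\mathbb{Z}^d$, sending the particle $(z,i)$ means adding to $A$ the first site outside $A$ visited by $S_{z,i}$ (its starting point if this is not in $A$). Starting from the empty set, send the $n$ particles of the source $0$; the resulting set is $A_n[0]$. For $M\ge 1$, the aggregate $A_n[M]$ is obtained from $A_n[M-1]$ by sending, one after the other, the $n$ particles of each source $(0,z)$ with $\|z\|_\infty=M$, these sources being taken in lexicographical order. Let $A_n[\infty]:=\bigcup_{M\ge 0}A_n[M]$. Then, for every $y\in\mathbb{Z}^{d-1}$, the number of sites of $A_n[\infty]$ on the line $\mathbb{Z}\times\{y\}$ is a random variable with values in $\{0,1,2,\dots\}\cup\{\infty\}$ and $$\mathbb{E}\left[\#\left(A_n[\infty]\cap(\mathbb{Z}\times\{y\})\right)\right]=n .$$ -/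

import Mathlib

open MeasureTheory ProbabilityTheory
open scoped ENNReal

/-- The lattice `ℤ^(m+1)`, i.e. `ℤ^d` with `d = m + 1`.  Coordinate `0` is the distinguished one. -/
abbrev Site (m : ℕ) : Type := Fin (m + 1) → ℤ

/-- The source `(0, z)` of the hyperplane `{0} × ℤ^m` attached to `z ∈ ℤ^m`. -/
def sourceSite {m : ℕ} (z : Fin m → ℤ) : Site m := Fin.cons 0 z

/-- The line `ℤ × {y}`, for `y ∈ ℤ^m`. -/
def line {m : ℕ} (y : Fin m → ℤ) : Set (Site m) := {x | ∀ i : Fin m, x i.succ = y i}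

/-- `S` is a simple symmetric random walk on `ℤ^(m+1)` started at `x`: its steps are i.i.d.,
uniform on the `2 (m + 1)` unit vectors `± e_j`. -/
structure IsSimpleRandomWalk {Ω : Type*} [MeasurableSpace Ω] {m : ℕ} (μ : Measure Ω)
    (x : Site m) (S : ℕ → Ω → Site m) : Prop where
  measurable : ∀ t, Measurable (S t)
  start : ∀ᵐ ω ∂μ, S 0 ω = x
  step_pos : ∀ (t : ℕ) (j : Fin (m + 1)),
    μ {ω | S (t + 1) ω - S t ω = Pi.single j 1} = (2 * ((m : ℝ≥0∞) + 1))⁻¹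
  step_neg : ∀ (t : ℕ) (j : Fin (m + 1)),
    μ {ω | S (t + 1) ω - S t ω = -Pi.single j 1} = (2 * ((m : ℝ≥0∞) + 1))⁻¹
  indep_steps : iIndepFun (fun (t : ℕ) (ω : Ω) => S (t + 1) ω - S t ω) μ

/-- The aggregate obtained from `A` by letting one particle follow the trajectory `s` until it
first leaves `A`: the exit site is added (nothing is added if `s` never leaves `A`). -/
def addParticle {m : ℕ} (A : Set (Site m)) (s : ℕ → Site m) : Set (Site m) :=
  A ∪ {x | ∃ t : ℕ, s t = x ∧ x ∉ A ∧ ∀ u < t, s u ∈ A}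

/-- The sup norm of a point of `ℤ^m`, which is also that of the source `(0, z)`. -/
def supNorm {m : ℕ} (z : Fin m → ℤ) : ℕ := Finset.univ.sup fun i => (z i).natAbs

/-- The sources of level `M`: the `z ∈ ℤ^m` with sup norm exactly `M`. -/
noncomputable def levelSources (m M : ℕ) : Finset (Fin m → ℤ) :=
  {z ∈ Fintype.piFinset fun _ : Fin m => Finset.Icc (-(M : ℤ)) M | supNorm z = M}

/-- The sources of level `M`, listed in increasing lexicographical order. -/
noncomputable def levelList (m M : ℕ) : List (Fin m → ℤ) :=
  (((levelSources m M).map toLex.toEmbedding).sort (· ≤ ·)).map ofLex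

/-- The particles of level `M`, in the order in which they are sent: the sources in
lexicographical order, and `n` particles from each of them. -/
noncomputable def levelParticles (m n M : ℕ) : List ((Fin m → ℤ) × Fin n) :=
  (levelList m M).flatMap fun z => (List.finRange n).map fun i => (z, i)

/-- The aggregate obtained from `A` by sending all the particles of level `M` one after the other;
`s z i` is the trajectory available to the `i`-th particle of the source `(0, z)`. -/
noncomputable def sendLevel {m n : ℕ} (s : (Fin m → ℤ) → Fin n → ℕ → Site m)
    (A : Set (Site m)) (M : ℕ) : Set (Site m) :=
  (levelParticles m n M).foldl (fun B p => addParticle B (s p.1 p.2)) A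

/-- The aggregate `A_n[M]` produced by the trajectories `s`. -/
noncomputable def aggregate {m n : ℕ} (s : (Fin m → ℤ) → Fin n → ℕ → Site m) :
    ℕ → Set (Site m)
  | 0 => sendLevel s ∅ 0
  | M + 1 => sendLevel s (aggregate s M) (M + 1)

/-- The limiting aggregate `A_n[∞]`, the union of all `A_n[M]`. -/
noncomputable def limitAggregate {m n : ℕ} (s : (Fin m → ℤ) → Fin n → ℕ → Site m) :
    Set (Site m) :=
  ⋃ M : ℕ, aggregate s M

/-! The randomness enters only through the operators `send z`: `send z f A` is the expected value of
`f` after a particle from `z` has been added to `A`. These operators commute (`send_comm`), so the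
expected weight `expMass L w` depends on the sources in `L` only as a multiset. Hence it grows when
particles are added anywhere in the list, and it is invariant under a joint translation of sources
and weight.

Upper bound (`expMass_lineWeight_le`). If the particles of `L` start in the box of radius `K`, their
translates by any `v` in the box of radius `M` are among all particles of the box of radius `M + K`.
The latter therefore put on each line `y + v` at least the expected number that `L` puts on the line
`y`. Summed over `v`, this is at most the number of particles, `n (2(M+K)+1)^m`; divide by
`(2M+1)^m` and let `M → ∞`.

Lower bound (`iSup_expMass_particlesUpTo`). By translation and monotonicity, the limit `c` for one
line bounds the expectation on every line. So the `n (2M+1)^m` particles of the box of radius `M`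
settle, up to `c (2(M+K)+1)^m` of them in expectation, on no line over the box of radius `M + K`.
Such a particle was still inside the earlier aggregate at time `K`. That aggregate is independent of
the walk and has at most `n` expected sites per line, so this has probability at most `n a(K)`,
where `a(K)` bounds the sum over lines of the largest point probability at time `K`. A Fourier
transform along the lines gives `a(K) → 0` (`exists_tendsto_tsum_iSup_killedWalk_le`). Letting `M →
∞`, then `K → ∞`, yields `n ≤ c`.

Independence of the walks identifies true expectations with iterated `send`
(`lintegral_foldl_addParticle`), and monotone convergence concludes. -/

/-- The average of `f` over the nearest neighbours of `x`. -/
noncomputable def nbrAvg {m : ℕ} (f : Site m → ℝ≥0∞) (x : Site m) : ℝ≥0∞ :=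
  (2 * ((m : ℝ≥0∞) + 1))⁻¹ * ∑ j, (f (x - Pi.single j 1) + f (x + Pi.single j 1))

/-- `killedWalk A z t x` is the probability that the simple random walk started at `z` is at `x`
at time `t` and lies in `A` at all times before `t`. -/
noncomputable def killedWalk {m : ℕ} (A : Set (Site m)) (z : Site m) : ℕ → Site m → ℝ≥0∞
  | 0 => Pi.single z 1
  | t + 1 => nbrAvg (A.indicator (killedWalk A z t))

/-- The probability that the simple random walk started at `z` leaves `A` at the site `x`. -/
noncomputable def exitDist {m : ℕ} (A : Set (Site m)) (z x : Site m) : ℝ≥0∞ :=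
  ∑' t, Aᶜ.indicator (killedWalk A z t) x

/-- The transition operator of the aggregate when a particle is sent from `z`. -/
noncomputable def send {m : ℕ} (z : Site m) (f : Set (Site m) → ℝ≥0∞) (A : Set (Site m)) :
    ℝ≥0∞ :=
  ∑' x, exitDist A z x * f (insert x A)

/-! ### Killed walks, exit distributions and the abelian property -/

section kernel
variable {m : ℕ}

lemma nbrAvg_add (f g : Site m → ℝ≥0∞) : nbrAvg (f + g) = nbrAvg f + nbrAvg g := by
  funext x
  simp only [nbrAvg, Pi.add_apply, ← mul_add, ← Finset.sum_add_distrib]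
  congr 1
  exact Finset.sum_congr rfl fun j _ => by ring

lemma nbrAvg_const_mul (c : ℝ≥0∞) (f : Site m → ℝ≥0∞) :
    nbrAvg (fun x => c * f x) = fun x => c * nbrAvg f x := by
  funext x
  simp only [nbrAvg, ← mul_add, ← Finset.mul_sum]
  ring

lemma nbrAvg_zero : nbrAvg (0 : Site m → ℝ≥0∞) = 0 := by
  funext x
  simp [nbrAvg]

lemma nbrAvg_sum {ι : Type*} (s : Finset ι) (f : ι → Site m → ℝ≥0∞) :
    nbrAvg (∑ i ∈ s, f i) = ∑ i ∈ s, nbrAvg (f i) := by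
  classical
  induction s using Finset.induction_on with
  | empty => simp [nbrAvg_zero]
  | insert a s ha ih => rw [Finset.sum_insert ha, Finset.sum_insert ha, nbrAvg_add, ih]

lemma nbrAvg_mono {f g : Site m → ℝ≥0∞} (h : f ≤ g) : nbrAvg f ≤ nbrAvg g := by
  intro x
  unfold nbrAvg
  gcongr
  · exact h _
  · exact h _

lemma inv_mul_two_mul_succ (m : ℕ) :
    (2 * ((m : ℝ≥0∞) + 1))⁻¹ * ((m + 1 : ℕ) * 2) = 1 := by
  have : ((m + 1 : ℕ) : ℝ≥0∞) * 2 = 2 * ((m : ℝ≥0∞) + 1) := by push_cast; ring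
  rw [this]
  refine ENNReal.inv_mul_cancel ?_ ?_
  · simp
  · exact ENNReal.mul_ne_top (by simp) (by simp)

lemma tsum_nbrAvg (f : Site m → ℝ≥0∞) : ∑' x, nbrAvg f x = ∑' x, f x := by
  unfold nbrAvg
  rw [ENNReal.tsum_mul_left]
  refine (congrArg _ (Summable.tsum_finsetSum fun _ _ => ENNReal.summable)).trans ?_
  have : ∀ j : Fin (m + 1),
      ∑' x : Site m, (f (x - Pi.single j 1) + f (x + Pi.single j 1)) = 2 * ∑' x, f x := by
    intro j
    rw [ENNReal.tsum_add, two_mul]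
    congr 1
    · exact (Equiv.subRight (Pi.single j 1 : Site m)).tsum_eq f
    · exact (Equiv.addRight (Pi.single j 1 : Site m)).tsum_eq f
  simp only [this, Finset.sum_const, Finset.card_univ, Fintype.card_fin, nsmul_eq_mul]
  rw [← mul_assoc, ← mul_assoc, mul_assoc _ _ (2 : ℝ≥0∞), inv_mul_two_mul_succ, one_mul]

lemma killedWalk_zero (A : Set (Site m)) (z : Site m) : killedWalk A z 0 = Pi.single z 1 := rfl

lemma killedWalk_succ (A : Set (Site m)) (z : Site m) (t : ℕ) :
    killedWalk A z (t + 1) = nbrAvg (A.indicator (killedWalk A z t)) := rfl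

lemma killedWalk_mono {A B : Set (Site m)} (h : A ⊆ B) (z : Site m) (t : ℕ) :
    killedWalk A z t ≤ killedWalk B z t := by
  induction t with
  | zero => exact le_rfl
  | succ t ih =>
    refine nbrAvg_mono fun x => ?_
    refine (Set.indicator_le_indicator_of_subset h (fun _ => zero_le) x).trans ?_
    exact Set.indicator_le_indicator (ih x)

lemma tsum_killedWalk_zero (A : Set (Site m)) (z : Site m) : ∑' x, killedWalk A z 0 x = 1 := by
  rw [killedWalk_zero, tsum_pi_single]

lemma tsum_killedWalk_succ (A : Set (Site m)) (z : Site m) (t : ℕ) :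
    ∑' x, killedWalk A z (t + 1) x = ∑' x, A.indicator (killedWalk A z t) x :=
  tsum_nbrAvg _

lemma tsum_killedWalk_eq (A : Set (Site m)) (z : Site m) (t : ℕ) :
    ∑' x, killedWalk A z t x
      = ∑' x, Aᶜ.indicator (killedWalk A z t) x + ∑' x, killedWalk A z (t + 1) x := by
  rw [tsum_killedWalk_succ, ← ENNReal.tsum_add]
  refine tsum_congr fun x => ?_
  rw [add_comm]
  exact (congrFun (Set.indicator_self_add_compl A (killedWalk A z t)) x).symm

/-- Mass balance: what leaves between the times `T` and `T + N`, and what is left. -/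
lemma sum_exit_add_tsum_killedWalk (A : Set (Site m)) (z : Site m) (T N : ℕ) :
    ∑ t ∈ Finset.range N, ∑' x, Aᶜ.indicator (killedWalk A z (T + t)) x
      + ∑' x, killedWalk A z (T + N) x = ∑' x, killedWalk A z T x := by
  induction N with
  | zero => simp
  | succ N ih =>
    rw [Finset.sum_range_succ, add_assoc, ← ih, tsum_killedWalk_eq A z (T + N), add_assoc]

lemma tsum_exit_le (A : Set (Site m)) (z : Site m) (T : ℕ) :
    ∑' t, ∑' x, Aᶜ.indicator (killedWalk A z (T + t)) x ≤ ∑' x, killedWalk A z T x := by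
  refine ENNReal.tsum_le_of_sum_range_le fun N => ?_
  rw [← sum_exit_add_tsum_killedWalk A z T N]
  exact le_self_add

lemma exitDist_of_mem {A : Set (Site m)} {x : Site m} (hx : x ∈ A) (z : Site m) :
    exitDist A z x = 0 := by
  simp [exitDist, hx]

lemma exitDist_of_notMem {A : Set (Site m)} {x : Site m} (hx : x ∉ A) (z : Site m) :
    exitDist A z x = ∑' t, killedWalk A z t x := by
  simp [exitDist, hx]

/-- Decomposition of the walk killed outside `insert x A` at the time it leaves `A` at `x`. -/
lemma killedWalk_insert {A : Set (Site m)} {x : Site m} (hx : x ∉ A) (z : Site m) (t : ℕ)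
    (y : Site m) :
    killedWalk (insert x A) z t y = killedWalk A z t y
      + ∑ s ∈ Finset.range t, killedWalk A z s x * killedWalk (insert x A) x (t - s) y := by
  induction t generalizing y with
  | zero => simp [killedWalk_zero]
  | succ t ih =>
    -- The middle term is the mass leaving `A` at `x` at time `t`; `insert x A` keeps it, and it
    -- becomes the summand `s = t` at the next time.
    have key : (insert x A).indicator (killedWalk (insert x A) z t)
        = A.indicator (killedWalk A z t)
          + ((fun y => killedWalk A z t x * (insert x A).indicator
                (killedWalk (insert x A) x 0) y)
          + ∑ s ∈ Finset.range t, fun y => killedWalk A z s x *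
              (insert x A).indicator (killedWalk (insert x A) x (t - s)) y) := by
      funext y
      simp only [Pi.add_apply, Finset.sum_apply]
      by_cases hy : y = x
      · subst hy
        simp [hx, ih, killedWalk_zero]
      · by_cases hyA : y ∈ A
        · simp [hy, hyA, ih, killedWalk_zero]
        · simp [hy, hyA]
    rw [killedWalk_succ, key, nbrAvg_add, nbrAvg_add, nbrAvg_sum, Finset.sum_range_succ]
    simp only [nbrAvg_const_mul, Pi.add_apply, Finset.sum_apply, ← killedWalk_succ]
    rw [add_comm (killedWalk A z t x * _)]
    congr 2
    · refine Finset.sum_congr rfl fun s hs => ?_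
      rw [Nat.sub_add_comm (Finset.mem_range.1 hs).le]
    · simp

lemma tsum_sum_range_mul (f g : ℕ → ℝ≥0∞) :
    ∑' t, ∑ s ∈ Finset.range (t + 1), f s * g (t - s) = (∑' s, f s) * ∑' s, g s := by
  rw [← ENNReal.tsum_mul_right]
  simp only [← ENNReal.tsum_mul_left]
  rw [← ENNReal.tsum_prod (f := fun a b => f a * g b),
    ← Finset.HasAntidiagonal.sigmaAntidiagonalEquivProd.tsum_eq, ENNReal.tsum_sigma']
  refine tsum_congr fun t => ?_
  rw [tsum_fintype, ← Finset.Nat.sum_antidiagonal_eq_sum_range_succ fun a b => f a * g b]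
  exact (Finset.sum_coe_sort (Finset.HasAntidiagonal.antidiagonal t)
    fun p : ℕ × ℕ => f p.1 * g p.2).symm

lemma exitDist_insert {A : Set (Site m)} {x y : Site m} (hx : x ∉ A) (hy : y ∉ A) (hxy : y ≠ x)
    (z : Site m) :
    exitDist (insert x A) z y
      = exitDist A z y + exitDist A z x * exitDist (insert x A) x y := by
  have hy' : y ∉ insert x A := by simp [hxy, hy]
  rw [exitDist_of_notMem hy', exitDist_of_notMem hy, exitDist_of_notMem hx,
    exitDist_of_notMem hy', ← tsum_sum_range_mul, ← ENNReal.tsum_add]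
  refine tsum_congr fun t => ?_
  -- The extra summand `s = t` of the Cauchy product vanishes: a walk restarted at `x` is not at `y
  -- ≠ x` at time `0`.
  rw [killedWalk_insert hx, Finset.sum_range_succ]
  simp [killedWalk_zero, hxy]

-- The second walk either leaves `A` directly at `y`, or leaves it at the freshly occupied `x` and
-- goes on from there.
open Classical in
lemma send_send (z w : Site m) (f : Set (Site m) → ℝ≥0∞) (A : Set (Site m)) :
    send z (send w f) A = ∑' x, ∑' y, (if x ∈ A ∨ y ∈ A ∨ x = y then 0 else
      (exitDist A z x * exitDist A w y
        + exitDist A z x * exitDist A w x * exitDist (insert x A) x y)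
        * f (insert y (insert x A))) := by
  unfold send
  refine tsum_congr fun x => ?_
  rw [← ENNReal.tsum_mul_left]
  refine tsum_congr fun y => ?_
  by_cases hx : x ∈ A
  · simp [hx, exitDist_of_mem]
  by_cases hy : y ∈ A
  · simp [hy, exitDist_of_mem]
  by_cases hxy : x = y
  · simp [hxy, exitDist_of_mem]
  rw [if_neg (by tauto), exitDist_insert hx hy (Ne.symm hxy)]
  ring

-- Of the two kinds of terms, those with distinct exit sites from `A` are exchanged by swapping `x`
-- and `y` with the particles. Those where both walks leave `A` at `x` are symmetric in `z` and `w`,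
-- since the continuation starts from `x` whichever particle makes it.
open Classical in
lemma send_comm (z w : Site m) (f : Set (Site m) → ℝ≥0∞) :
    send z (send w f) = send w (send z f) := by
  funext A
  have split : ∀ z w : Site m, send z (send w f) A
      = (∑' x, ∑' y, if x ∈ A ∨ y ∈ A ∨ x = y then 0 else
          exitDist A z x * exitDist A w y * f (insert y (insert x A)))
        + ∑' x, ∑' y, if x ∈ A ∨ y ∈ A ∨ x = y then 0 else
          exitDist A z x * exitDist A w x * exitDist (insert x A) x y
            * f (insert y (insert x A)) := by
    intro z w
    rw [send_send, ← ENNReal.tsum_add]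
    refine tsum_congr fun x => ?_
    rw [← ENNReal.tsum_add]
    refine tsum_congr fun y => ?_
    split_ifs <;> ring
  rw [split z w, split w z, ENNReal.tsum_comm]
  congr 1
  · refine tsum_congr fun x => tsum_congr fun y => ?_
    rw [Set.insert_comm x y]
    refine if_congr (by tauto) rfl (by ring)
  · refine tsum_congr fun x => tsum_congr fun y => ?_
    exact if_congr Iff.rfl rfl (by ring)

/-- Makes `List.Perm.foldr_eq` available, hence independence of the order of the sources. -/
instance : LeftCommutative (send (m := m)) := ⟨send_comm⟩

/-! ### Translations -/

lemma nbrAvg_add_right (f : Site m → ℝ≥0∞) (v x : Site m) :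
    nbrAvg f (x + v) = nbrAvg (fun y => f (y + v)) x := by
  simp only [nbrAvg, add_sub_right_comm, add_right_comm]

lemma killedWalk_add_right (A : Set (Site m)) (z v : Site m) (t : ℕ) (x : Site m) :
    killedWalk A (z + v) t (x + v) = killedWalk ((· + v) ⁻¹' A) z t x := by
  induction t generalizing x with
  | zero => simp [killedWalk_zero, Pi.single_apply]
  | succ t ih =>
    rw [killedWalk_succ, killedWalk_succ, nbrAvg_add_right]
    congr 1
    funext y
    by_cases hy : y + v ∈ A <;> simp [hy, ih]

lemma exitDist_add_right (A : Set (Site m)) (z v x : Site m) :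
    exitDist A (z + v) (x + v) = exitDist ((· + v) ⁻¹' A) z x := by
  refine tsum_congr fun t => ?_
  by_cases hx : x + v ∈ A <;> simp [hx, killedWalk_add_right]

lemma send_add_right (z v : Site m) (f : Set (Site m) → ℝ≥0∞) (A : Set (Site m)) :
    send (z + v) (fun B => f ((· + v) ⁻¹' B)) A = send z f ((· + v) ⁻¹' A) := by
  unfold send
  rw [← (Equiv.addRight v).tsum_eq]
  refine tsum_congr fun x => ?_
  simp only [Equiv.coe_addRight, exitDist_add_right]
  congr 2
  ext y
  simp

lemma foldr_send_add_right (L : List (Site m)) (v : Site m) (f : Set (Site m) → ℝ≥0∞)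
    (A : Set (Site m)) :
    (L.map (· + v)).foldr send (fun B => f ((· + v) ⁻¹' B)) A
      = L.foldr send f ((· + v) ⁻¹' A) := by
  induction L generalizing A with
  | nil => rfl
  | cons z L ih =>
    rw [List.map_cons, List.foldr_cons, List.foldr_cons, ← send_add_right]
    congr 1
    exact funext ih

/-! ### Linearity -/

lemma send_add (z : Site m) (f g : Set (Site m) → ℝ≥0∞) :
    send z (fun A => f A + g A) = fun A => send z f A + send z g A := by
  funext A
  simp only [send, mul_add, ENNReal.tsum_add]

lemma send_tsum {ι : Type*} (z : Site m) (c : ι → ℝ≥0∞) (f : ι → Set (Site m) → ℝ≥0∞) :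
    send z (fun A => ∑' i, c i * f i A) = fun A => ∑' i, c i * send z (f i) A := by
  funext A
  simp only [send, ← ENNReal.tsum_mul_left]
  rw [ENNReal.tsum_comm]
  exact tsum_congr fun i => tsum_congr fun x => by ring

lemma foldr_send_add (L : List (Site m)) (f g : Set (Site m) → ℝ≥0∞) :
    L.foldr send (fun A => f A + g A) = fun A => L.foldr send f A + L.foldr send g A := by
  induction L with
  | nil => rfl
  | cons z L ih => rw [List.foldr_cons, ih, send_add]; rfl

lemma foldr_send_tsum {ι : Type*} (L : List (Site m)) (c : ι → ℝ≥0∞)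
    (f : ι → Set (Site m) → ℝ≥0∞) :
    L.foldr send (fun A => ∑' i, c i * f i A) = fun A => ∑' i, c i * L.foldr send (f i) A := by
  induction L with
  | nil => rfl
  | cons z L ih => rw [List.foldr_cons, ih, send_tsum]; rfl

/-- Comparing on finite sets only is what later allows inequalities relying on almost sure exit. -/
lemma send_mono {z : Site m} {f g : Set (Site m) → ℝ≥0∞} (h : ∀ A, A.Finite → f A ≤ g A)
    {A : Set (Site m)} (hA : A.Finite) : send z f A ≤ send z g A :=
  ENNReal.tsum_le_tsum fun x => mul_le_mul_right (h _ (hA.insert x)) _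

lemma foldr_send_mono (L : List (Site m)) {f g : Set (Site m) → ℝ≥0∞}
    (h : ∀ A, A.Finite → f A ≤ g A) {A : Set (Site m)} (hA : A.Finite) :
    L.foldr send f A ≤ L.foldr send g A := by
  induction L generalizing A with
  | nil => exact h A hA
  | cons z L ih => exact send_mono (fun B hB => ih hB) hA

end kernel

/-! ### Decay of the walk's point probabilities, by Fourier transform along the lines -/

/-- The Fourier transform, in the distinguished coordinate, of the law at time `t` of the simple
random walk started at `(0, z)`. -/
noncomputable def fourierWalk {m : ℕ} (z : Fin m → ℤ) : ℕ → ℝ → (Fin m → ℤ) → ℝ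
  | 0, _ => Pi.single z 1
  | t + 1, θ => fun y => (2 * ((m : ℝ) + 1))⁻¹ * (2 * Real.cos θ * fourierWalk z t θ y
      + ∑ j, (fourierWalk z t θ (y - Pi.single j 1) + fourierWalk z t θ (y + Pi.single j 1)))

section fourier
open Filter Topology
variable {m : ℕ}

lemma nbrAvg_cons (f : Site m → ℝ≥0∞) (h : ℤ) (y : Fin m → ℤ) :
    nbrAvg f (Fin.cons h y : Site m) = (2 * ((m : ℝ≥0∞) + 1))⁻¹ *
      (f (Fin.cons (h - 1) y : Site m) + f (Fin.cons (h + 1) y : Site m)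
        + ∑ j, (f (Fin.cons h (y - Pi.single j 1) : Site m)
          + f (Fin.cons h (y + Pi.single j 1) : Site m))) := by
  have h0 : (Pi.single 0 1 : Site m) = Fin.cons 1 0 := by
    funext i
    refine Fin.cases ?_ (fun i => ?_) i <;> simp
  have hs : ∀ j : Fin m, (Pi.single j.succ 1 : Site m) = Fin.cons 0 (Pi.single j 1) := by
    intro j
    funext i
    refine Fin.cases ?_ (fun i => ?_) i <;> simp [Pi.single_apply, (Fin.succ_ne_zero _).symm]
  have hadd : ∀ (a b : ℤ) (u v : Fin m → ℤ),
      (Fin.cons a u : Site m) + (Fin.cons b v : Site m) = (Fin.cons (a + b) (u + v) : Site m) := by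
    intro a b u v
    funext i
    refine Fin.cases ?_ (fun i => ?_) i <;> simp
  have hsub : ∀ (a b : ℤ) (u v : Fin m → ℤ),
      (Fin.cons a u : Site m) - (Fin.cons b v : Site m) = (Fin.cons (a - b) (u - v) : Site m) := by
    intro a b u v
    funext i
    refine Fin.cases ?_ (fun i => ?_) i <;> simp
  simp only [nbrAvg, Fin.sum_univ_succ, h0, hs, hadd, hsub, add_zero, sub_zero]

lemma killedWalk_univ_ne_top (z : Site m) (t : ℕ) (x : Site m) :
    killedWalk Set.univ z t x ≠ ⊤ := by
  have h1 : ∀ t, ∑' x, killedWalk Set.univ z t x = 1 := by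
    intro t
    induction t with
    | zero => exact tsum_killedWalk_zero _ z
    | succ t ih => rw [tsum_killedWalk_succ, Set.indicator_univ, ih]
  exact ne_top_of_le_ne_top ENNReal.one_ne_top ((ENNReal.le_tsum x).trans (h1 t).le)

lemma continuous_fourierWalk (z : Fin m → ℤ) (t : ℕ) (y : Fin m → ℤ) :
    Continuous fun θ => fourierWalk z t θ y := by
  induction t generalizing y with
  | zero => exact continuous_const
  | succ t ih =>
    have := ih y
    have h1 := fun j : Fin m => ih (y - Pi.single j 1)
    have h2 := fun j : Fin m => ih (y + Pi.single j 1)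
    simp only [fourierWalk]
    fun_prop

lemma integral_cos_int_mul (h : ℤ) :
    ∫ θ in (0 : ℝ)..(2 * Real.pi), Real.cos (h * θ) = if h = 0 then 2 * Real.pi else 0 := by
  split_ifs with hh
  · simp [hh]
  · have hh' : (h : ℝ) ≠ 0 := by exact_mod_cast hh
    rw [intervalIntegral.integral_comp_mul_left (fun θ => Real.cos θ) hh', integral_cos]
    have : Real.sin (h * (2 * Real.pi)) = 0 := by
      have := Real.sin_int_mul_pi (h * 2)
      push_cast at this
      rw [← this]; ring_nf
    simp [this]

/-- Fourier inversion; cosines suffice because the law is symmetric in the distinguished coordinate.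
-/
lemma toReal_killedWalk_univ (z : Fin m → ℤ) (t : ℕ) (h : ℤ) (y : Fin m → ℤ) :
    (killedWalk Set.univ (sourceSite z) t (Fin.cons h y : Site m)).toReal
      = (2 * Real.pi)⁻¹ * ∫ θ in (0 : ℝ)..(2 * Real.pi),
          fourierWalk z t θ y * Real.cos (h * θ) := by
  induction t generalizing h y with
  | zero =>
    have : (Fin.cons h y : Site m) = sourceSite z ↔ h = 0 ∧ y = z := Fin.cons_inj
    rw [killedWalk_zero, Pi.single_apply]
    simp only [this, fourierWalk, intervalIntegral.integral_const_mul, integral_cos_int_mul,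
      Pi.single_apply]
    by_cases h1 : h = 0 <;> by_cases h2 : y = z <;> simp [h1, h2]
    field_simp
  | succ t ih =>
    have hc := continuous_fourierWalk z t
    have hii : ∀ (y : Fin m → ℤ) (h : ℤ), IntervalIntegrable
        (fun θ => fourierWalk z t θ y * Real.cos (h * θ)) volume 0 (2 * Real.pi) := by
      intro y h
      have := hc y
      exact Continuous.intervalIntegrable (by fun_prop) _ _
    have hsum : IntervalIntegrable (fun θ => ∑ j : Fin m,
        (fourierWalk z t θ (y - Pi.single j 1) * Real.cos (h * θ)
          + fourierWalk z t θ (y + Pi.single j 1) * Real.cos (h * θ)))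
        volume 0 (2 * Real.pi) := by
      have h1 := fun j : Fin m => hc (y - Pi.single j 1)
      have h2 := fun j : Fin m => hc (y + Pi.single j 1)
      exact Continuous.intervalIntegrable (by fun_prop) _ _
    have hn := killedWalk_univ_ne_top (sourceSite z) t
    rw [killedWalk_succ, Set.indicator_univ, nbrAvg_cons, ENNReal.toReal_mul,
      ENNReal.toReal_add (by simp [hn]) (ENNReal.sum_ne_top.2 fun j _ => by simp [hn]),
      ENNReal.toReal_add (hn _) (hn _), ENNReal.toReal_sum fun j _ => by simp [hn]]
    simp only [ENNReal.toReal_add (hn _) (hn _), ih]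
    simp only [← mul_add, ← Finset.mul_sum]
    rw [mul_left_comm]
    congr 1
    simp only [← intervalIntegral.integral_add (hii _ _) (hii _ _)]
    rw [← intervalIntegral.integral_finsetSum fun j _ => (hii _ _).add (hii _ _),
      ← intervalIntegral.integral_add ((hii _ _).add (hii _ _)) hsum,
      show (2 * ((m : ℝ≥0∞) + 1))⁻¹.toReal = (2 * ((m : ℝ) + 1))⁻¹ by
        rw [ENNReal.toReal_inv, ENNReal.toReal_mul, ENNReal.toReal_add (by simp) (by simp)]; simp,
      ← intervalIntegral.integral_const_mul]
    congr 1
    funext θ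
    simp only [fourierWalk, ← add_mul, ← Finset.sum_mul, mul_assoc]
    congr 1
    rw [add_mul, mul_assoc, mul_assoc]
    congr 1
    push_cast
    -- `cos ((h-1)θ) + cos ((h+1)θ) = 2 cos θ cos (hθ)`.
    simp only [sub_mul, add_mul, one_mul, Real.cos_sub, Real.cos_add]
    ring

/-- One step is multiplication by `cos θ / (m+1)` plus `2m` shifts of weight `1 / (2(m+1))`, and
shifts preserve the `ℓ¹` norm. -/
lemma tsum_enorm_fourierWalk_le (z : Fin m → ℤ) (t : ℕ) (θ : ℝ) :
    ∑' y, ‖fourierWalk z t θ y‖ₑ ≤ ENNReal.ofReal (((|Real.cos θ| + m) / (m + 1)) ^ t) := by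
  induction t with
  | zero =>
    have : ∀ y, ‖fourierWalk z 0 θ y‖ₑ = (Pi.single z 1 : (Fin m → ℤ) → ℝ≥0∞) y := by
      intro y
      by_cases hy : y = z <;> simp [fourierWalk, hy]
    simp [this]
  | succ t ih =>
    set b := fun y => ‖fourierWalk z t θ y‖ₑ with hb
    have hle : ∀ y, ‖fourierWalk z (t + 1) θ y‖ₑ ≤ ENNReal.ofReal (2 * (m + 1))⁻¹ *
        (ENNReal.ofReal (2 * |Real.cos θ|) * b y
          + ∑ j : Fin m, (b (y - Pi.single j 1) + b (y + Pi.single j 1))) := by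
      intro y
      simp only [fourierWalk, enorm_mul]
      gcongr
      · rw [Real.enorm_eq_ofReal (by positivity)]
      · refine (enorm_add_le _ _).trans ?_
        gcongr
        · simp only [enorm_mul, hb]
          rw [ENNReal.ofReal_mul (by norm_num), ← Real.enorm_eq_ofReal_abs, Real.enorm_eq_ofReal]
          norm_num
        · refine (enorm_sum_le _ _).trans ?_
          gcongr
          exact enorm_add_le _ _
    refine (ENNReal.tsum_le_tsum hle).trans ?_
    rw [ENNReal.tsum_mul_left, ENNReal.tsum_add, ENNReal.tsum_mul_left]
    have hsum : ∑' y : Fin m → ℤ, ∑ j : Fin m, (b (y - Pi.single j 1) + b (y + Pi.single j 1))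
        = ENNReal.ofReal (2 * m) * ∑' y, b y := by
      refine (Summable.tsum_finsetSum fun _ _ => ENNReal.summable).trans ?_
      have : ∀ j : Fin m, ∑' y : Fin m → ℤ, (b (y - Pi.single j 1) + b (y + Pi.single j 1))
          = 2 * ∑' y, b y := by
        intro j
        rw [ENNReal.tsum_add, two_mul]
        congr 1
        · exact (Equiv.subRight (Pi.single j 1 : Fin m → ℤ)).tsum_eq b
        · exact (Equiv.addRight (Pi.single j 1 : Fin m → ℤ)).tsum_eq b
      simp only [this, Finset.sum_const, Finset.card_univ, Fintype.card_fin, nsmul_eq_mul]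
      rw [ENNReal.ofReal_mul (by norm_num), ENNReal.ofReal_natCast, ← mul_assoc, mul_comm (m : ℝ≥0∞)]
      norm_num
    rw [pow_succ', ENNReal.ofReal_mul (p := (|Real.cos θ| + m) / (m + 1)) (by positivity), hsum, ← add_mul,
      ← ENNReal.ofReal_add (by positivity) (by positivity), ← mul_assoc,
      ← ENNReal.ofReal_mul (by positivity)]
    refine mul_le_mul' (le_of_eq ?_) ih
    congr 1
    field_simp

lemma ae_abs_cos_lt_one : ∀ᵐ θ : ℝ, |Real.cos θ| < 1 := by
  have hc : (Set.range fun k : ℤ => (k : ℝ) * Real.pi).Countable := Set.countable_range _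
  filter_upwards [hc.ae_notMem volume] with θ hθ
  refine lt_of_le_of_ne (Real.abs_cos_le_one θ) fun h => hθ ?_
  have h2 : Real.sin θ = 0 := by
    have := Real.sin_sq_add_cos_sq θ
    rw [← sq_abs (Real.cos θ), h] at this
    nlinarith
  exact Real.sin_eq_zero_iff.1 h2

/-- The largest probabilities on the lines `ℤ × {y}` at time `t`, summed over `y`, tend to `0`. -/
lemma exists_tendsto_tsum_iSup_killedWalk_le (m : ℕ) :
    ∃ a : ℕ → ℝ≥0∞, Tendsto a atTop (𝓝 0) ∧ ∀ (z : Fin m → ℤ) (t : ℕ),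
      ∑' y, ⨆ h : ℤ, killedWalk Set.univ (sourceSite z) t (Fin.cons h y : Site m) ≤ a t := by
  set ν : Measure ℝ := volume.restrict (Set.Ioc 0 (2 * Real.pi))
  refine ⟨fun t => ‖(2 * Real.pi)⁻¹‖ₑ *
    ∫⁻ θ, ENNReal.ofReal (((|Real.cos θ| + m) / (m + 1)) ^ t) ∂ν, ?_, fun z t => ?_⟩
  · have h0 : Tendsto (fun t : ℕ => ∫⁻ θ, ENNReal.ofReal (((|Real.cos θ| + m) / (m + 1)) ^ t) ∂ν)
        atTop (𝓝 (∫⁻ _, 0 ∂ν)) := by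
      refine tendsto_lintegral_of_dominated_convergence (fun _ => 1) (fun t => ?_) (fun t => ?_)
        ?_ ?_
      · exact ENNReal.measurable_ofReal.comp (by fun_prop)
      · refine Eventually.of_forall fun θ => ?_
        rw [ENNReal.ofReal_le_one]
        refine pow_le_one₀ (by positivity) ?_
        rw [div_le_one (by positivity)]
        linarith [Real.abs_cos_le_one θ]
      · simp [ν, ENNReal.mul_eq_top]
      · filter_upwards [ae_restrict_of_ae ae_abs_cos_lt_one] with θ hθ
        rw [← ENNReal.ofReal_zero]
        refine ENNReal.tendsto_ofReal (tendsto_pow_atTop_nhds_zero_of_lt_one (by positivity) ?_)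
        rw [div_lt_one (by positivity)]
        linarith
    have := ENNReal.Tendsto.const_mul (a := ‖(2 * Real.pi)⁻¹‖ₑ) h0 (Or.inr enorm_ne_top)
    simpa using this
  · calc
      -- The height `h` occurs only in a cosine of modulus at most `1`, so the bound survives the
      -- supremum over `h`.
      _ ≤ ∑' y, ‖(2 * Real.pi)⁻¹‖ₑ * ∫⁻ θ, ‖fourierWalk z t θ y‖ₑ ∂ν := by
        refine ENNReal.tsum_le_tsum fun y => iSup_le fun h => ?_
        rw [← ENNReal.ofReal_toReal (killedWalk_univ_ne_top (sourceSite z) t _),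
          ← Real.enorm_eq_ofReal ENNReal.toReal_nonneg, toReal_killedWalk_univ, enorm_mul,
          intervalIntegral.integral_of_le (by positivity)]
        gcongr
        refine (enorm_integral_le_lintegral_enorm _).trans (lintegral_mono fun θ => ?_)
        rw [enorm_mul]
        refine mul_le_of_le_one_right' ?_
        rw [Real.enorm_eq_ofReal_abs, ENNReal.ofReal_le_one]
        exact Real.abs_cos_le_one _
      _ ≤ _ := by
        rw [ENNReal.tsum_mul_left, ← lintegral_tsum fun y =>
          (continuous_fourierWalk z t y).enorm.aemeasurable]
        exact mul_le_mul_right (lintegral_mono fun θ => tsum_enorm_fourierWalk_le z t θ) _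

end fourier

/-! ### Weights of sets, almost sure exit and late exits -/

/-- The total weight of the sites of `A`. -/
noncomputable def mass {m : ℕ} (w : Site m → ℝ≥0∞) (A : Set (Site m)) : ℝ≥0∞ :=
  ∑' x, A.indicator w x

section mass
open Filter Topology
variable {m : ℕ}

lemma tendsto_killedWalk_univ (z : Fin m → ℤ) (x : Site m) :
    Tendsto (fun t => killedWalk Set.univ (sourceSite z) t x) atTop (𝓝 0) := by
  obtain ⟨a, ha, hle⟩ := exists_tendsto_tsum_iSup_killedWalk_le m
  refine tendsto_of_tendsto_of_tendsto_of_le_of_le tendsto_const_nhds ha (fun _ => zero_le)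
    fun t => ?_
  refine le_trans ?_ ((ENNReal.le_tsum (Fin.tail x)).trans (hle z t))
  conv_lhs => rw [← Fin.cons_self_tail x]
  exact le_iSup (fun h : ℤ => killedWalk Set.univ (sourceSite z) t
    (Fin.cons h (Fin.tail x) : Site m)) (x 0)

/-- Survival to time `t + 1` forces the walk to be in `A` at time `t`; the rest of the past is
forgotten. -/
lemma tsum_killedWalk_succ_le_mass (A : Set (Site m)) (z : Site m) (t : ℕ) :
    ∑' x, killedWalk A z (t + 1) x ≤ mass (killedWalk Set.univ z t) A := by
  rw [tsum_killedWalk_succ]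
  exact ENNReal.tsum_le_tsum fun x =>
    Set.indicator_le_indicator (killedWalk_mono (Set.subset_univ A) z t x)

lemma mass_eq_sum {A : Set (Site m)} (hA : A.Finite) (w : Site m → ℝ≥0∞) :
    mass w A = ∑ x ∈ hA.toFinset, w x := by
  rw [mass, tsum_eq_sum (s := hA.toFinset)]
  · exact Finset.sum_congr rfl fun x hx => Set.indicator_of_mem (hA.mem_toFinset.1 hx) w
  · intro x hx
    exact Set.indicator_of_notMem (fun h => hx (hA.mem_toFinset.2 h)) w

/-- The walk leaves a finite set almost surely. -/
lemma tsum_exitDist {A : Set (Site m)} (hA : A.Finite) (z : Fin m → ℤ) :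
    ∑' x, exitDist A (sourceSite z) x = 1 := by
  have h0 : Tendsto (fun t => ∑' x, killedWalk A (sourceSite z) t x) atTop (𝓝 0) := by
    rw [← tendsto_add_atTop_iff_nat 1]
    have : Tendsto (fun t => mass (killedWalk Set.univ (sourceSite z) t) A) atTop (𝓝 0) := by
      simp only [mass_eq_sum hA]
      simpa using tendsto_finsetSum hA.toFinset fun x _ => tendsto_killedWalk_univ z x
    exact tendsto_of_tendsto_of_tendsto_of_le_of_le tendsto_const_nhds this (fun _ => zero_le)
      fun t => tsum_killedWalk_succ_le_mass A _ t
  have h1 := fun N => sum_exit_add_tsum_killedWalk A (sourceSite z) 0 N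
  simp only [zero_add, tsum_killedWalk_zero] at h1
  unfold exitDist
  rw [ENNReal.tsum_comm]
  have h2 := (ENNReal.tendsto_nat_tsum fun t =>
    ∑' x, Aᶜ.indicator (killedWalk A (sourceSite z) t) x).add h0
  simp only [h1, add_zero] at h2
  exact tendsto_nhds_unique h2 tendsto_const_nhds

lemma killedWalk_eq_zero_of_dist (A : Set (Site m)) (z : Site m) {t : ℕ} {x : Site m}
    {i : Fin (m + 1)} (h : t < (x i - z i).natAbs) : killedWalk A z t x = 0 := by
  induction t generalizing x with
  | zero =>
    rw [killedWalk_zero, Pi.single_apply, if_neg]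
    rintro rfl
    simp at h
  | succ t ih =>
    have h1 : ∀ j, A.indicator (killedWalk A z t) (x - Pi.single j 1) = 0 := by
      intro j
      refine Set.indicator_apply_eq_zero.2 fun _ => ih ?_
      by_cases hj : i = j
      · subst hj
        simp only [Pi.sub_apply, Pi.single_eq_same]
        omega
      · simp only [Pi.sub_apply, Pi.single_eq_of_ne hj]
        omega
    have h2 : ∀ j, A.indicator (killedWalk A z t) (x + Pi.single j 1) = 0 := by
      intro j
      refine Set.indicator_apply_eq_zero.2 fun _ => ih ?_
      by_cases hj : i = j
      · subst hj
        simp only [Pi.add_apply, Pi.single_eq_same]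
        omega
      · simp only [Pi.add_apply, Pi.single_eq_of_ne hj]
        omega
    simp [killedWalk_succ, nbrAvg, h1, h2]

/-- A weight that vanishes within distance `K` of `z` is collected only by a walk that stays
in `A` up to time `K`. -/
lemma tsum_exitDist_mul_le (A : Set (Site m)) (z : Site m) (K : ℕ) (w : Site m → ℝ≥0∞)
    (hw1 : ∀ x, w x ≤ 1) (hw : ∀ x, (∀ i, (x i - z i).natAbs ≤ K) → w x = 0) :
    ∑' x, exitDist A z x * w x ≤ mass (killedWalk Set.univ z K) A := by
  refine le_trans ?_ (tsum_killedWalk_succ_le_mass A z K)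
  -- Only exits at times at least `K + 1` count: the walk moves by one unit per step.
  refine le_trans ?_ (tsum_exit_le A z (K + 1))
  rw [ENNReal.tsum_comm]
  refine ENNReal.tsum_le_tsum fun x => ?_
  by_cases hx : ∀ i, (x i - z i).natAbs ≤ K
  · simp [hw x hx]
  · refine (mul_le_of_le_one_right' (hw1 x)).trans ?_
    push Not at hx
    obtain ⟨i, hi⟩ := hx
    rw [exitDist, ← ENNReal.summable.sum_add_tsum_nat_add' (k := K + 1), Finset.sum_eq_zero,
      zero_add]
    · exact ENNReal.tsum_le_tsum fun t => by rw [add_comm]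
    · intro t ht
      refine Set.indicator_apply_eq_zero.2 fun _ =>
        killedWalk_eq_zero_of_dist A z (i := i) ?_
      have := Finset.mem_range.1 ht
      omega

lemma mass_mono {v w : Site m → ℝ≥0∞} (h : v ≤ w) (A : Set (Site m)) : mass v A ≤ mass w A :=
  ENNReal.tsum_le_tsum fun x => Set.indicator_le_indicator (h x)

lemma mass_empty (w : Site m → ℝ≥0∞) : mass w ∅ = 0 := by simp [mass]

lemma mass_insert {A : Set (Site m)} {x : Site m} (hx : x ∉ A) (w : Site m → ℝ≥0∞) :
    mass w (insert x A) = mass w A + w x := by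
  have : ∀ y, (insert x A).indicator w y = A.indicator w y + (Pi.single x (w x) : _ → ℝ≥0∞) y := by
    intro y
    by_cases hy : y = x
    · subst hy; simp [hx]
    · by_cases hyA : y ∈ A <;> simp [hy, hyA]
  simp only [mass, this, ENNReal.tsum_add, tsum_pi_single]

lemma mass_add (v w : Site m → ℝ≥0∞) (A : Set (Site m)) :
    mass (fun x => v x + w x) A = mass v A + mass w A := by
  rw [mass, mass, mass, ← ENNReal.tsum_add]
  exact tsum_congr fun x => Set.indicator_add' A v w ▸ rfl

lemma mass_tsum {ι : Type*} (c : ι → ℝ≥0∞) (w : ι → Site m → ℝ≥0∞) (A : Set (Site m)) :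
    mass (fun x => ∑' i, c i * w i x) A = ∑' i, c i * mass (w i) A := by
  simp only [mass, ← ENNReal.tsum_mul_left]
  rw [ENNReal.tsum_comm]
  refine tsum_congr fun x => ?_
  by_cases hx : x ∈ A <;> simp [hx]

lemma mass_preimage (w : Site m → ℝ≥0∞) (v : Site m) (A : Set (Site m)) :
    mass w A = mass (fun x => w (x + v)) ((· + v) ⁻¹' A) := by
  rw [mass, ← (Equiv.addRight v).tsum_eq]
  rfl

/-- The added site is always new, so weights add; finiteness ensures that the exit probabilities sum
to one. -/
lemma send_mass {A : Set (Site m)} (hA : A.Finite) (z : Fin m → ℤ) (w : Site m → ℝ≥0∞) :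
    send (sourceSite z) (mass w) A
      = mass w A + ∑' x, exitDist A (sourceSite z) x * w x := by
  have : ∀ x, exitDist A (sourceSite z) x * mass w (insert x A)
      = exitDist A (sourceSite z) x * mass w A + exitDist A (sourceSite z) x * w x := by
    intro x
    by_cases hx : x ∈ A
    · simp [exitDist_of_mem hx]
    · rw [mass_insert hx, mul_add]
  simp only [send, this, ENNReal.tsum_add, ENNReal.tsum_mul_right, tsum_exitDist hA z, one_mul]

end mass

/-! ### Expected weights: order, monotonicity, translations -/

/-- The expected weight of the aggregate obtained from the empty set by sending one particle from
each source of the list `L`. -/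
noncomputable def expMass {m : ℕ} (L : List (Fin m → ℤ)) (w : Site m → ℝ≥0∞) : ℝ≥0∞ :=
  (L.map sourceSite).foldr send (mass w) ∅

/-- The indicator function of the line `ℤ × {y}`. -/
noncomputable def lineWeight {m : ℕ} (y : Fin m → ℤ) : Site m → ℝ≥0∞ :=
  (line y).indicator 1

section expMass
variable {m : ℕ}

lemma expMass_perm {L L' : List (Fin m → ℤ)} (h : L.Perm L') (w : Site m → ℝ≥0∞) :
    expMass L w = expMass L' w := by
  rw [expMass, (h.map sourceSite).foldr_eq]
  rfl

lemma expMass_mono (L : List (Fin m → ℤ)) {v w : Site m → ℝ≥0∞} (h : v ≤ w) :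
    expMass L v ≤ expMass L w :=
  foldr_send_mono _ (fun A _ => mass_mono h A) Set.finite_empty

lemma expMass_add (L : List (Fin m → ℤ)) (v w : Site m → ℝ≥0∞) :
    expMass L (fun x => v x + w x) = expMass L v + expMass L w := by
  unfold expMass
  rw [funext (mass_add v w), foldr_send_add]

lemma expMass_tsum {ι : Type*} (L : List (Fin m → ℤ)) (c : ι → ℝ≥0∞) (w : ι → Site m → ℝ≥0∞) :
    expMass L (fun x => ∑' i, c i * w i x) = ∑' i, c i * expMass L (w i) := by
  unfold expMass
  rw [funext (mass_tsum c w), foldr_send_tsum]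

lemma expMass_sum {ι : Type*} (L : List (Fin m → ℤ)) (s : Finset ι) (w : ι → Site m → ℝ≥0∞) :
    expMass L (fun x => ∑ i ∈ s, w i x) = ∑ i ∈ s, expMass L (w i) := by
  have := expMass_tsum L (fun _ : s => 1) fun i => w i
  simp only [one_mul] at this
  rw [← Finset.tsum_subtype s fun i => expMass L (w i), ← this]
  congr 1
  funext x
  exact (Finset.tsum_subtype s fun i => w i x).symm

lemma mass_le_foldr_send (L : List (Fin m → ℤ)) (w : Site m → ℝ≥0∞) {A : Set (Site m)}
    (hA : A.Finite) : mass w A ≤ (L.map sourceSite).foldr send (mass w) A := by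
  induction L generalizing A with
  | nil => exact le_rfl
  | cons z L ih =>
    calc mass w A ≤ send (sourceSite z) (mass w) A := by rw [send_mass hA]; exact le_self_add
      _ ≤ _ := send_mono (fun B hB => ih hB) hA

lemma expMass_le_append (L L' : List (Fin m → ℤ)) (w : Site m → ℝ≥0∞) :
    expMass L w ≤ expMass (L ++ L') w := by
  unfold expMass
  rw [List.map_append, List.foldr_append]
  exact foldr_send_mono _ (fun A hA => mass_le_foldr_send L' w hA) Set.finite_empty

/-- By commutativity the particles missing from `L` may be sent last, where they only add sites. -/
lemma expMass_subperm {L L' : List (Fin m → ℤ)} (h : L.Subperm L') (w : Site m → ℝ≥0∞) :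
    expMass L w ≤ expMass L' w := by
  rw [← expMass_perm (List.subperm_append_diff_self_of_count_le
    (List.subperm_ext_iff.1 h)) w]
  exact expMass_le_append _ _ _

/-- Conservation of mass: every particle settles almost surely, on a new site. -/
lemma expMass_one (L : List (Fin m → ℤ)) : expMass L 1 = L.length := by
  have : ∀ A : Set (Site m), A.Finite →
      (L.map sourceSite).foldr send (mass 1) A = mass 1 A + L.length := by
    induction L with
    | nil => simp
    | cons z L ih =>
      intro A hA
      have h1 : send (sourceSite z) ((L.map sourceSite).foldr send (mass 1)) A
          = send (sourceSite z) (fun A => mass 1 A + L.length) A :=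
        le_antisymm (send_mono (fun B hB => (ih B hB).le) hA)
          (send_mono (fun B hB => (ih B hB).ge) hA)
      have h2 : send (sourceSite z) (fun _ => (L.length : ℝ≥0∞)) A = L.length := by
        rw [send, ENNReal.tsum_mul_right, tsum_exitDist hA, one_mul]
      rw [List.map_cons, List.foldr_cons, h1, send_add]
      simp only [h2, send_mass hA, Pi.one_apply, mul_one, tsum_exitDist hA, List.length_cons]
      push_cast
      ring
  rw [expMass, this ∅ Set.finite_empty, mass_empty, zero_add]

lemma sourceSite_add (z v : Fin m → ℤ) : sourceSite (z + v) = sourceSite z + sourceSite v := by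
  funext i
  refine Fin.cases ?_ (fun i => ?_) i <;> simp [sourceSite]

lemma expMass_map_add (L : List (Fin m → ℤ)) (v : Fin m → ℤ) (w : Site m → ℝ≥0∞) :
    expMass (L.map (· + v)) w = expMass L fun x => w (x + sourceSite v) := by
  unfold expMass
  have h : (L.map (· + v)).map sourceSite = (L.map sourceSite).map (· + sourceSite v) := by
    simp [List.map_map, Function.comp_def, sourceSite_add]
  rw [h, funext (mass_preimage w (sourceSite v)), foldr_send_add_right, Set.preimage_empty]

/-- The last particle collects weight only if its walk is still in the aggregate of `L` at time `K`;
averaging the free walk's law over that aggregate gives the second term. -/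
lemma expMass_append_singleton_le (L : List (Fin m → ℤ)) (z : Fin m → ℤ) (K : ℕ)
    (w : Site m → ℝ≥0∞) (hw1 : ∀ x, w x ≤ 1)
    (hw : ∀ x, (∀ i, (x i - sourceSite z i).natAbs ≤ K) → w x = 0) :
    expMass (L ++ [z]) w ≤ expMass L w + expMass L (killedWalk Set.univ (sourceSite z) K) := by
  rw [← expMass_add]
  unfold expMass
  rw [List.map_append, List.foldr_append]
  refine foldr_send_mono _ (fun A hA => ?_) Set.finite_empty
  rw [List.map_singleton, List.foldr_cons, List.foldr_nil, send_mass hA, mass_add]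
  gcongr
  exact tsum_exitDist_mul_le A _ K w hw1 hw

lemma mem_line_iff {x : Site m} {y : Fin m → ℤ} : x ∈ line y ↔ y = Fin.tail x :=
  ⟨fun h => funext fun i => (h i).symm, fun h i => by rw [h]; rfl⟩

lemma tsum_mul_lineWeight (c : (Fin m → ℤ) → ℝ≥0∞) (x : Site m) :
    ∑' y, c y * lineWeight y x = c (Fin.tail x) := by
  rw [tsum_eq_single (Fin.tail x)]
  · simp [lineWeight, mem_line_iff]
  · intro y hy
    simp [lineWeight, mem_line_iff, hy]

lemma lineWeight_add_sourceSite (y v : Fin m → ℤ) (x : Site m) :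
    lineWeight (y + v) (x + sourceSite v) = lineWeight y x := by
  have : x + sourceSite v ∈ line (y + v) ↔ x ∈ line y := by
    simp [line, sourceSite]
  by_cases h : x ∈ line y
  · rw [lineWeight, lineWeight, Set.indicator_of_mem h, Set.indicator_of_mem (this.2 h)]; rfl
  · rw [lineWeight, lineWeight, Set.indicator_of_notMem h,
      Set.indicator_of_notMem (mt this.1 h)]

lemma mass_lineWeight (y : Fin m → ℤ) (A : Set (Site m)) :
    mass (lineWeight y) A = ((A ∩ line y).encard : ℝ≥0∞) := by
  rw [← ENNReal.tsum_set_one, tsum_subtype (A ∩ line y) fun _ => (1 : ℝ≥0∞), mass]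
  refine tsum_congr fun x => ?_
  rw [lineWeight, Set.indicator_indicator]
  rfl

/-- Replacing the walk's law by its maximum on each line leaves a combination of line weights, so
only expected counts per line matter. -/
lemma expMass_killedWalk_le (L : List (Fin m → ℤ)) (z : Fin m → ℤ) (t : ℕ) (c : ℝ≥0∞)
    (h : ∀ y, expMass L (lineWeight y) ≤ c) :
    expMass L (killedWalk Set.univ (sourceSite z) t) ≤
      (∑' y, ⨆ h : ℤ, killedWalk Set.univ (sourceSite z) t (Fin.cons h y : Site m)) * c := by
  calc expMass L (killedWalk Set.univ (sourceSite z) t)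
      ≤ expMass L (fun x => ∑' y, (⨆ h : ℤ, killedWalk Set.univ (sourceSite z) t
          (Fin.cons h y : Site m)) * lineWeight y x) := by
        refine expMass_mono L fun x => ?_
        beta_reduce
        rw [tsum_mul_lineWeight]
        conv_lhs => rw [← Fin.cons_self_tail x]
        exact le_iSup (fun h : ℤ => killedWalk Set.univ (sourceSite z) t
          (Fin.cons h (Fin.tail x) : Site m)) (x 0)
    _ ≤ _ := by
        rw [expMass_tsum, ← ENNReal.tsum_mul_right]
        exact ENNReal.tsum_le_tsum fun y => mul_le_mul_right (h y) _

end expMass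

/-! ### The particles of a box -/

/-- The particles of the levels `0, …, M`, in the order in which they are sent. -/
noncomputable def particlesUpTo (m n M : ℕ) : List ((Fin m → ℤ) × Fin n) :=
  (List.range (M + 1)).flatMap (levelParticles m n)

/-- The `z ∈ ℤ^m` with sup norm at most `M`. -/
noncomputable def boxSources (m M : ℕ) : Finset (Fin m → ℤ) :=
  Fintype.piFinset fun _ : Fin m => Finset.Icc (-(M : ℤ)) M

section particles
open Filter Topology
variable {m n : ℕ}

lemma mem_boxSources {M : ℕ} {z : Fin m → ℤ} : z ∈ boxSources m M ↔ ∀ i, (z i).natAbs ≤ M := by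
  simp only [boxSources, Fintype.mem_piFinset, Finset.mem_Icc]
  exact forall_congr' fun i => by omega

lemma mem_boxSources_iff_supNorm {M : ℕ} {z : Fin m → ℤ} :
    z ∈ boxSources m M ↔ supNorm z ≤ M := by
  simp [mem_boxSources, supNorm]

lemma card_boxSources (m M : ℕ) : (boxSources m M).card = (2 * M + 1) ^ m := by
  rw [boxSources, Fintype.card_piFinset_const, Int.card_Icc]
  congr 1
  omega

lemma mem_levelList {M : ℕ} {z : Fin m → ℤ} : z ∈ levelList m M ↔ supNorm z = M := by
  have : supNorm z = M → z ∈ boxSources m M := fun h => mem_boxSources_iff_supNorm.2 h.le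
  rw [boxSources] at this
  simp only [levelList, levelSources, List.mem_map, Finset.mem_sort, Finset.mem_map,
    Finset.mem_filter]
  constructor
  · rintro ⟨_, ⟨z', ⟨_, h⟩, rfl⟩, rfl⟩
    exact h
  · exact fun h => ⟨toLex z, ⟨z, ⟨this h, h⟩, rfl⟩, rfl⟩

lemma nodup_levelList (m M : ℕ) : (levelList m M).Nodup :=
  (Finset.sort_nodup _ _).map ofLex.injective

lemma mem_levelParticles {M : ℕ} {p : (Fin m → ℤ) × Fin n} :
    p ∈ levelParticles m n M ↔ supNorm p.1 = M := by
  obtain ⟨z, i⟩ := p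
  simp [levelParticles, mem_levelList]

lemma nodup_levelParticles (m n M : ℕ) : (levelParticles m n M).Nodup := by
  refine List.nodup_flatMap.2 ⟨fun z _ => ?_, (nodup_levelList m M).imp fun {z w} hzw => ?_⟩
  · exact (List.nodup_finRange n).map fun i j h => (Prod.mk.inj h).2
  · simp only [Function.onFun, List.disjoint_left, List.mem_map, not_exists, not_and]
    rintro _ ⟨i, _, rfl⟩ j _ h
    exact hzw (Prod.mk.inj h).1.symm

lemma mem_particlesUpTo {M : ℕ} {p : (Fin m → ℤ) × Fin n} :
    p ∈ particlesUpTo m n M ↔ p.1 ∈ boxSources m M := by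
  simp [particlesUpTo, mem_levelParticles, mem_boxSources_iff_supNorm]

lemma nodup_particlesUpTo (m n M : ℕ) : (particlesUpTo m n M).Nodup := by
  refine List.nodup_flatMap.2 ⟨fun k _ => nodup_levelParticles m n k,
    List.nodup_range.imp fun {k l} hkl => ?_⟩
  simp only [Function.onFun, List.disjoint_left, mem_levelParticles]
  rintro p rfl
  exact hkl

lemma length_particlesUpTo (m n M : ℕ) :
    (particlesUpTo m n M).length = (2 * M + 1) ^ m * n := by
  classical
  rw [← List.toFinset_card_of_nodup (nodup_particlesUpTo m n M), ← card_boxSources]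
  have : (particlesUpTo m n M).toFinset = boxSources m M ×ˢ (Finset.univ : Finset (Fin n)) := by
    ext p
    simp [mem_particlesUpTo]
  rw [this, Finset.card_product, Finset.card_univ, Fintype.card_fin]

/-! ### Comparison of lines and the density argument -/

/-- Sending more particles, from translated sources, can only increase expected weights. -/
lemma expMass_le_expMass_add {L L' : List ((Fin m → ℤ) × Fin n)} (hL : L.Nodup) (v : Fin m → ℤ)
    (h : ∀ p ∈ L, (p.1 + v, p.2) ∈ L') (y : Fin m → ℤ) :
    expMass (L.map Prod.fst) (lineWeight y) ≤ expMass (L'.map Prod.fst) (lineWeight (y + v)) := by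
  have h1 : expMass (L.map Prod.fst) (lineWeight y)
      = expMass ((L.map fun p => (p.1 + v, p.2)).map Prod.fst) (lineWeight (y + v)) := by
    have : (L.map fun p => (p.1 + v, p.2)).map Prod.fst = (L.map Prod.fst).map (· + v) := by
      simp [List.map_map, Function.comp_def]
    rw [this, expMass_map_add]
    simp only [lineWeight_add_sourceSite]
  rw [h1]
  have hinj : Function.Injective fun p : (Fin m → ℤ) × Fin n => (p.1 + v, p.2) := by
    rintro ⟨a, i⟩ ⟨b, j⟩ hab
    simpa using hab
  have hsubset : L.map (fun p => (p.1 + v, p.2)) ⊆ L' := by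
    intro q hq
    obtain ⟨p, hp, rfl⟩ := List.mem_map.1 hq
    exact h p hp
  obtain ⟨l, hl, hsub⟩ := List.subperm_of_subset (hL.map hinj) hsubset
  exact expMass_subperm ⟨l.map Prod.fst, hl.map _, hsub.map _⟩ _

/-- Enlarging the box by a fixed `K` does not change its volume to leading order: the ratio of sides
is `1 + 2K / (2M+1)`. -/
lemma le_add_of_forall_mul_pow_le {a b c : ℝ≥0∞} (hb : b ≠ ⊤) (K m : ℕ)
    (h : ∀ M : ℕ, a * ((2 * M + 1 : ℕ) : ℝ≥0∞) ^ m
      ≤ b * ((2 * (M + K) + 1 : ℕ) : ℝ≥0∞) ^ m + c * ((2 * M + 1 : ℕ) : ℝ≥0∞) ^ m) :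
    a ≤ b + c := by
  set r : ℕ → ℝ≥0∞ := fun M =>
    (((2 * (M + K) + 1 : ℕ) : ℝ≥0∞) / ((2 * M + 1 : ℕ) : ℝ≥0∞)) ^ m with hr
  have hr1 : Tendsto r atTop (𝓝 1) := by
    have h0 : Tendsto (fun M : ℕ => 1 + (2 * K : ℝ) / (2 * M + 1 : ℕ)) atTop (𝓝 (1 + 0)) := by
      refine tendsto_const_nhds.add (Tendsto.div_atTop tendsto_const_nhds ?_)
      refine tendsto_natCast_atTop_atTop.comp ?_
      exact tendsto_atTop_mono (fun M => by simp only [id]; omega) tendsto_id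
    have h1 := ENNReal.Tendsto.pow (n := m) (ENNReal.tendsto_ofReal h0)
    simp only [add_zero, ENNReal.ofReal_one, one_pow] at h1
    refine h1.congr fun M => ?_
    rw [hr]
    congr 1
    rw [← ENNReal.ofReal_natCast, ← ENNReal.ofReal_natCast (2 * M + 1),
      ← ENNReal.ofReal_div_of_pos (by positivity)]
    congr 1
    have : ((2 * M + 1 : ℕ) : ℝ) ≠ 0 := by positivity
    field_simp
    push_cast
    ring
  have hle : ∀ M, a ≤ b * r M + c := by
    intro M
    have h0 : ((2 * M + 1 : ℕ) : ℝ≥0∞) ^ m ≠ 0 := pow_ne_zero _ (by positivity)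
    have ht : ((2 * M + 1 : ℕ) : ℝ≥0∞) ^ m ≠ ⊤ := ENNReal.pow_ne_top (ENNReal.natCast_ne_top _)
    refine (ENNReal.mul_le_mul_iff_left h0 ht).1 ((h M).trans_eq ?_)
    rw [add_mul, hr, mul_assoc, ← mul_pow, ENNReal.div_mul_cancel (by positivity)
      (ENNReal.natCast_ne_top _)]
  have hlim : Tendsto (fun M => b * r M + c) atTop (𝓝 (b * 1 + c)) :=
    (ENNReal.Tendsto.const_mul hr1 (Or.inr hb)).add tendsto_const_nhds
  rw [mul_one] at hlim
  exact ge_of_tendsto' hlim hle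

lemma add_mem_boxSources {M K : ℕ} {z v : Fin m → ℤ} (hz : z ∈ boxSources m M)
    (hv : v ∈ boxSources m K) : z + v ∈ boxSources m (M + K) := by
  rw [mem_boxSources] at *
  exact fun i => (Int.natAbs_add_le _ _).trans (Nat.add_le_add (hz i) (hv i))

/-- The expected number of sites on a line is at most `n`. -/
lemma expMass_lineWeight_le {L : List ((Fin m → ℤ) × Fin n)} (hL : L.Nodup) (y : Fin m → ℤ) :
    expMass (L.map Prod.fst) (lineWeight y) ≤ n := by
  classical
  -- A radius such that all sources of `L` lie in the box.
  set K := L.toFinset.sup fun p => supNorm p.1 with hK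
  have hbox : ∀ p ∈ L, p.1 ∈ boxSources m K := fun p hp => mem_boxSources_iff_supNorm.2
    (Finset.le_sup (f := fun p : (Fin m → ℤ) × Fin n => supNorm p.1) (List.mem_toFinset.2 hp))
  rw [← add_zero (n : ℝ≥0∞)]
  refine le_add_of_forall_mul_pow_le (ENNReal.natCast_ne_top n) K m fun M => ?_
  set P := (particlesUpTo m n (M + K)).map Prod.fst with hP
  calc expMass (L.map Prod.fst) (lineWeight y) * ((2 * M + 1 : ℕ) : ℝ≥0∞) ^ m
      = ∑ _v ∈ boxSources m M, expMass (L.map Prod.fst) (lineWeight y) := by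
        rw [Finset.sum_const, card_boxSources, nsmul_eq_mul, mul_comm]
        push_cast
        rfl
    _ ≤ ∑ v ∈ boxSources m M, expMass P (lineWeight (y + v)) := by
        refine Finset.sum_le_sum fun v hv => expMass_le_expMass_add hL v (fun p hp => ?_) y
        rw [mem_particlesUpTo, add_comm M K]
        exact add_mem_boxSources (hbox p hp) hv
    _ ≤ ∑' v, expMass P (lineWeight (y + v)) := ENNReal.sum_le_tsum _
    _ = ∑' v, 1 * expMass P (lineWeight v) := by
        simp only [one_mul]
        exact (Equiv.addLeft y).tsum_eq fun v => expMass P (lineWeight v)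
    _ = n * ((2 * (M + K) + 1 : ℕ) : ℝ≥0∞) ^ m + 0 * ((2 * M + 1 : ℕ) : ℝ≥0∞) ^ m := by
        rw [← expMass_tsum]
        simp only [tsum_mul_lineWeight fun _ => 1]
        have := expMass_one P
        rw [hP, List.length_map, length_particlesUpTo] at this
        rw [zero_mul, add_zero, mul_comm]
        exact_mod_cast this

open Classical in
/-- The indicator function of the set of sites on none of the lines through a box. -/
noncomputable def outsideWeight (m R : ℕ) (x : Site m) : ℝ≥0∞ :=
  if Fin.tail x ∈ boxSources m R then 0 else 1

/-- Each particle must travel farther than `K` to contribute. Its cost is at most `a * n`, by the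
upper bound on lines applied to the particles sent before it. -/
lemma expMass_outsideWeight_le {M K : ℕ} {a : ℝ≥0∞}
    (ha : ∀ z : Fin m → ℤ,
      ∑' y, ⨆ h : ℤ, killedWalk Set.univ (sourceSite z) K (Fin.cons h y : Site m) ≤ a)
    {L : List ((Fin m → ℤ) × Fin n)} (hL : L.Nodup) (hM : ∀ p ∈ L, p.1 ∈ boxSources m M) :
    expMass (L.map Prod.fst) (outsideWeight m (M + K)) ≤ L.length * (a * n) := by
  induction L using List.reverseRecOn with
  | nil => simp [expMass, mass_empty]
  | append_singleton L p ih =>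
    have hL' : L.Nodup := hL.of_append_left
    rw [List.map_append, List.map_singleton]
    refine (expMass_append_singleton_le _ p.1 K _ (fun x => ?_) fun x hx => ?_).trans ?_
    · unfold outsideWeight; split_ifs <;> simp
    · rw [outsideWeight, if_pos]
      have hp := mem_boxSources.1 (hM p (by simp))
      refine mem_boxSources.2 fun i => ?_
      have h1 := hx i.succ
      have h2 := hp i
      simp only [sourceSite, Fin.cons_succ] at h1
      rw [Fin.tail]
      omega
    · rw [List.length_append, List.length_singleton, Nat.cast_add, Nat.cast_one, add_mul, one_mul]
      gcongr
      · exact ih hL' fun q hq => hM q (by simp [hq])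
      · refine (expMass_killedWalk_le _ p.1 K n fun y => expMass_lineWeight_le hL' y).trans ?_
        gcongr
        exact ha p.1

/-- The expected number of sites of the aggregates on a given line increases to `n`. -/
lemma iSup_expMass_particlesUpTo (m n : ℕ) (y : Fin m → ℤ) :
    ⨆ M, expMass ((particlesUpTo m n M).map Prod.fst) (lineWeight y) = n := by
  refine le_antisymm (iSup_le fun M => expMass_lineWeight_le (nodup_particlesUpTo m n M) y) ?_
  set c := ⨆ M, expMass ((particlesUpTo m n M).map Prod.fst) (lineWeight y) with hc
  have hcn : c ≤ n := iSup_le fun M => expMass_lineWeight_le (nodup_particlesUpTo m n M) y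
  obtain ⟨a, ha, hle⟩ := exists_tendsto_tsum_iSup_killedWalk_le m
  have key : ∀ K, (n : ℝ≥0∞) ≤ c + n * (a K * n) := by
    intro K
    refine le_add_of_forall_mul_pow_le (ne_top_of_le_ne_top (ENNReal.natCast_ne_top n) hcn) K m
      fun M => ?_
    set P := (particlesUpTo m n M).map Prod.fst with hP
    have hlen : (P.length : ℝ≥0∞) = n * ((2 * M + 1 : ℕ) : ℝ≥0∞) ^ m := by
      rw [hP, List.length_map, length_particlesUpTo, mul_comm]
      push_cast
      ring
    calc (n : ℝ≥0∞) * ((2 * M + 1 : ℕ) : ℝ≥0∞) ^ m = expMass P 1 := by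
          rw [expMass_one, hlen]
      _ ≤ expMass P (fun x => ∑ v ∈ boxSources m (M + K), lineWeight v x
            + outsideWeight m (M + K) x) := by
          refine expMass_mono P fun x => ?_
          unfold outsideWeight
          split_ifs with hx
          · refine le_trans ?_ (le_self_add.trans' (Finset.single_le_sum
              (f := fun v => lineWeight v x) (fun _ _ => zero_le) hx))
            simp [lineWeight, mem_line_iff]
          · exact le_add_self
      _ ≤ _ := by
          rw [expMass_add, expMass_sum]
          gcongr
          · calc ∑ v ∈ boxSources m (M + K), expMass P (lineWeight v)
                ≤ ∑ v ∈ boxSources m (M + K), c := by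
                  refine Finset.sum_le_sum fun v _ => ?_
                  -- Translating by `y - v` moves the line `v` onto `y` and the box of radius `M`
                  -- into that of radius `M + R`.
                  set R := supNorm (y - v)
                  refine le_trans ?_ (le_iSup _ (M + R))
                  have := expMass_le_expMass_add (nodup_particlesUpTo m n M) (y - v)
                    (L' := particlesUpTo m n (M + R)) (fun p hp => ?_) v
                  · rwa [add_sub_cancel] at this
                  · rw [mem_particlesUpTo] at hp ⊢
                    exact add_mem_boxSources hp (mem_boxSources_iff_supNorm.2 le_rfl)
              _ = _ := by
                  rw [Finset.sum_const, card_boxSources, nsmul_eq_mul, mul_comm]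
                  push_cast
                  rfl
          · refine (expMass_outsideWeight_le (fun z => hle z K) (nodup_particlesUpTo m n M)
              fun p hp => mem_particlesUpTo.1 hp).trans_eq ?_
            rw [← List.length_map (f := Prod.fst), ← hP, hlen]
            ring
  have hlim : Tendsto (fun K => c + n * (a K * n)) atTop (𝓝 (c + n * (0 * n))) :=
    tendsto_const_nhds.add (ENNReal.Tendsto.const_mul
      (ENNReal.Tendsto.mul_const ha (Or.inr (ENNReal.natCast_ne_top n)))
      (Or.inr (ENNReal.natCast_ne_top n)))
  rw [zero_mul, mul_zero, add_zero] at hlim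
  exact ge_of_tendsto' hlim key

end particles

/-! ### From the random walks to the kernels: the law of the exit site -/

/-- The unit vectors `± e_j`. -/
def unitVec {m : ℕ} (p : Fin (m + 1) × Bool) : Site m :=
  if p.2 then Pi.single p.1 1 else -Pi.single p.1 1

section exit
variable {Ω : Type*} {m : ℕ} {S : ℕ → Ω → Site m}

/-- The event that the walk leaves `A` at `x`. -/
def exitEvent (S : ℕ → Ω → Site m) (A : Set (Site m)) (x : Site m) : Set Ω :=
  {ω | ∃ t, S t ω = x ∧ x ∉ A ∧ ∀ u < t, S u ω ∈ A}

lemma exit_time_unique {A : Set (Site m)} {s : ℕ → Site m} {t u : ℕ} (ht : s t ∉ A)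
    (ht' : ∀ r < t, s r ∈ A) (hu : s u ∉ A) (hu' : ∀ r < u, s r ∈ A) : t = u := by
  rcases lt_trichotomy t u with h | h | h
  · exact absurd (hu' t h) ht
  · exact h
  · exact absurd (ht' u h) hu

lemma exitEvent_eq_iUnion {A : Set (Site m)} {x : Site m} (hx : x ∉ A) :
    exitEvent S A x = ⋃ t, {ω | S t ω = x ∧ ∀ u < t, S u ω ∈ A} := by
  ext ω
  simp [exitEvent, hx]

lemma disjoint_exitEvent (S : ℕ → Ω → Site m) (A : Set (Site m)) :
    Pairwise (Function.onFun Disjoint (exitEvent S A)) := by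
  intro x y hxy
  refine Set.disjoint_left.2 ?_
  rintro ω ⟨t, rfl, hx, ht⟩ ⟨u, rfl, hy, hu⟩
  exact hxy (by rw [exit_time_unique (s := fun t => S t ω) hx ht hy hu])

lemma addParticle_of_mem_exitEvent {A : Set (Site m)} {x : Site m} {ω : Ω}
    (h : ω ∈ exitEvent S A x) : addParticle A (fun t => S t ω) = insert x A := by
  obtain ⟨t, rfl, hx, ht⟩ := h
  ext y
  simp only [addParticle, Set.mem_union, Set.mem_ofPred_eq, Set.mem_insert_iff]
  rw [or_comm]
  refine or_congr_left ⟨?_, ?_⟩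
  · rintro ⟨u, rfl, hy, hu⟩
    rw [exit_time_unique (s := fun t => S t ω) hx ht hy hu]
  · rintro rfl
    exact ⟨t, rfl, hx, ht⟩

end exit

section walk
variable {Ω : Type*} [MeasurableSpace Ω] {μ : Measure Ω} {m : ℕ} {z : Site m}
  {S : ℕ → Ω → Site m}

lemma unitVec_injective : Function.Injective (unitVec (m := m)) := by
  rintro ⟨j, b⟩ ⟨k, c⟩ h
  have hj := congrFun h j
  by_cases hjk : j = k
  · subst hjk
    cases b <;> cases c <;> first | rfl | simp [unitVec] at hj
  · cases b <;> cases c <;> simp [unitVec, Pi.single_eq_of_ne hjk] at hj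

lemma measurable_steps (hS : IsSimpleRandomWalk μ z S) (t : ℕ) :
    Measurable fun ω => S (t + 1) ω - S t ω :=
  (hS.measurable (t + 1)).sub (hS.measurable t)

lemma tsum_measure_preimage_singleton_eq_one [IsProbabilityMeasure μ] {X : Ω → Site m}
    (hX : Measurable X) : ∑' v, μ {ω | X ω = v} = 1 := by
  rw [← measure_univ (μ := μ), ← measure_iUnion]
  · congr 1
    ext ω
    simp
  · intro v w hvw
    refine Set.disjoint_left.2 fun ω h1 h2 => hvw ?_
    exact h1.symm.trans h2
  · exact fun v => hX (measurableSet_singleton v)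

lemma measure_step_unitVec (hS : IsSimpleRandomWalk μ z S) (t : ℕ) (p : Fin (m + 1) × Bool) :
    μ {ω | S (t + 1) ω - S t ω = unitVec p} = (2 * ((m : ℝ≥0∞) + 1))⁻¹ := by
  obtain ⟨j, b⟩ := p
  cases b
  · simpa [unitVec] using hS.step_neg t j
  · simpa [unitVec] using hS.step_pos t j

/-- The expectation of a function of a step. -/
lemma tsum_mul_measure_step [IsProbabilityMeasure μ] (hS : IsSimpleRandomWalk μ z S) (t : ℕ)
    (f : Site m → ℝ≥0∞) (y : Site m) :
    ∑' v, f (y - v) * μ {ω | S (t + 1) ω - S t ω = v} = nbrAvg f y := by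
  set U : Finset (Site m) := Finset.univ.map ⟨unitVec, unitVec_injective⟩ with hU
  set Q : Site m → ℝ≥0∞ := fun v => μ {ω | S (t + 1) ω - S t ω = v} with hQ
  have hQp : ∀ p, Q (unitVec p) = (2 * ((m : ℝ≥0∞) + 1))⁻¹ := measure_step_unitVec hS t
  have hsumU : ∑ v ∈ U, Q v = 1 := by
    rw [hU, Finset.sum_map]
    simp only [Function.Embedding.coeFn_mk, hQp, Finset.sum_const, Finset.card_univ,
      Fintype.card_prod, Fintype.card_fin, Fintype.card_bool, nsmul_eq_mul]
    have := inv_mul_two_mul_succ m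
    push_cast at this ⊢
    rw [mul_comm, this]
  -- The unit vectors already carry total probability one.
  have hQ0 : ∀ v, v ∉ U → Q v = 0 := by
    intro v hv
    have h1 : ∑ w ∈ insert v U, Q w ≤ 1 :=
      (ENNReal.sum_le_tsum _).trans_eq (tsum_measure_preimage_singleton_eq_one (measurable_steps hS t))
    rw [Finset.sum_insert hv, hsumU] at h1
    have h2 : Q v + 1 ≤ 0 + 1 := by simpa using h1
    exact le_antisymm ((ENNReal.add_le_add_iff_right ENNReal.one_ne_top).1 h2) zero_le
  change ∑' v, f (y - v) * Q v = nbrAvg f y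
  rw [tsum_eq_sum (s := U) fun v hv => by rw [hQ0 v hv, mul_zero], hU, Finset.sum_map]
  simp only [Function.Embedding.coeFn_mk, hQp, Fintype.sum_prod_type, Fintype.sum_bool, nbrAvg,
    Finset.mul_sum]
  refine Finset.sum_congr rfl fun j _ => ?_
  simp [unitVec]
  ring

lemma ae_eq_add_sum_steps (hS : IsSimpleRandomWalk μ z S) :
    ∀ᵐ ω ∂μ, ∀ t, S t ω = z + ∑ s ∈ Finset.range t, (S (s + 1) ω - S s ω) := by
  filter_upwards [hS.start] with ω hω t
  rw [Finset.sum_range_sub (fun s => S s ω), hω]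
  abel

/-- The probability to be at `x` at time `t`, after a path in `A`. -/
lemma measure_killedWalk [IsProbabilityMeasure μ] (hS : IsSimpleRandomWalk μ z S)
    (A : Set (Site m)) (t : ℕ) (x : Site m) :
    μ {ω | S t ω = x ∧ ∀ u < t, S u ω ∈ A} = killedWalk A z t x := by
  set X : ℕ → Ω → Site m := fun s ω => S (s + 1) ω - S s ω with hX
  -- The starting point of `S` is only almost surely `z`; `T` is genuinely a function of the steps,
  -- hence measurable for their σ-algebra.
  set T : ℕ → Ω → Site m := fun t ω => z + ∑ s ∈ Finset.range t, X s ω with hT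
  have hST : ∀ t x, μ {ω | S t ω = x ∧ ∀ u < t, S u ω ∈ A}
      = μ {ω | T t ω = x ∧ ∀ u < t, T u ω ∈ A} := by
    intro t x
    refine measure_congr ?_
    filter_upwards [ae_eq_add_sum_steps hS] with ω hω
    have hω' : ∀ t, S t ω = T t ω := hω
    apply propext
    change (S t ω = x ∧ ∀ u < t, S u ω ∈ A) ↔ (T t ω = x ∧ ∀ u < t, T u ω ∈ A)
    simp only [hω']
  rw [hST]
  have hXm : ∀ s, Measurable (X s) := measurable_steps hS
  induction t generalizing x with
  | zero =>
    by_cases hx : x = z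
    · simp [hT, killedWalk_zero, hx]
    · simp [hT, killedWalk_zero, hx, Ne.symm hx]
  | succ t ih =>
    set past : ℕ → MeasurableSpace Ω := fun t =>
      ⨆ s ∈ Set.Iio t, MeasurableSpace.comap (X s) inferInstance with hpast
    have hTm : ∀ u ≤ t, Measurable[past t] (T u) := by
      intro u hu
      refine Measurable.const_add (Finset.measurable_fun_sum _ fun s hs => ?_) z
      refine Measurable.mono (comap_measurable (X s)) ?_ le_rfl
      exact le_iSup₂_of_le s ((Finset.mem_range.1 hs).trans_le hu) le_rfl
    have hE : ∀ y, MeasurableSet[past t] {ω | T t ω = y ∧ ∀ u < t, T u ω ∈ A} := by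
      intro y
      have : {ω | T t ω = y ∧ ∀ u < t, T u ω ∈ A}
          = T t ⁻¹' {y} ∩ ⋂ u, ⋂ (_ : u < t), T u ⁻¹' A := by
        ext ω
        simp
      rw [this]
      exact (hTm t le_rfl (measurableSet_singleton y)).inter (MeasurableSet.iInter fun u =>
        MeasurableSet.iInter fun hu => hTm u hu.le (MeasurableSet.of_discrete))
    have hindep : Indep (past t) (MeasurableSpace.comap (X t) inferInstance) μ := by
      have := indep_iSup_of_disjoint (fun s => (hXm s).comap_le) hS.indep_steps
        (S := Set.Iio t) (T := {t}) (by simp)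
      simpa only [iSup_singleton, Set.mem_singleton_iff, iSup_iSup_eq_left] using this
    have hle : past t ≤ ‹MeasurableSpace Ω› := iSup₂_le fun s _ => (hXm s).comap_le
    -- Split according to the last step `v`, which is independent of the past.
    have hunion : {ω | T (t + 1) ω = x ∧ ∀ u < t + 1, T u ω ∈ A}
        = ⋃ v, ({ω | x - v ∈ A ∧ T t ω = x - v ∧ ∀ u < t, T u ω ∈ A} ∩ X t ⁻¹' {v}) := by
      ext ω
      have hT1 : T (t + 1) ω = T t ω + X t ω := by
        simp only [hT, Finset.sum_range_succ, add_assoc]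
      simp only [Set.mem_ofPred_eq, Set.mem_iUnion, Set.mem_inter_iff, Set.mem_preimage,
        Set.mem_singleton_iff, exists_eq_right', hT1, Nat.lt_succ_iff_lt_or_eq]
      constructor
      · rintro ⟨rfl, h⟩
        refine ⟨?_, by simp, fun u hu => h u (Or.inl hu)⟩
        simpa using h t (Or.inr rfl)
      · rintro ⟨h1, h2, h3⟩
        refine ⟨by rw [h2]; simp, ?_⟩
        rintro u (hu | rfl)
        · exact h3 u hu
        · rwa [h2]
    have hpast_v : ∀ v, MeasurableSet[past t]
        {ω | x - v ∈ A ∧ T t ω = x - v ∧ ∀ u < t, T u ω ∈ A} := by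
      intro v
      by_cases hv : x - v ∈ A
      · simpa [hv] using hE (x - v)
      · simp [hv]
    rw [hunion, measure_iUnion, killedWalk_succ, ← tsum_mul_measure_step hS t]
    · refine tsum_congr fun v => ?_
      rw [(Indep_iff _ _ μ).1 hindep _ _ (hpast_v v) ⟨{v}, measurableSet_singleton v, rfl⟩]
      congr 1
      by_cases hv : x - v ∈ A
      · simp only [hv, true_and, Set.indicator_of_mem]
        exact ih (x - v)
      · simp [hv]
    · intro v w hvw
      refine Set.disjoint_left.2 fun ω h1 h2 => hvw ?_
      exact h1.2.symm.trans h2.2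
    · exact fun v => (hle _ (hpast_v v)).inter (hXm t (measurableSet_singleton v))

lemma measurableSet_walk (hS : ∀ t, Measurable (S t)) (A : Set (Site m)) (t : ℕ) (x : Site m) :
    MeasurableSet {ω | S t ω = x ∧ ∀ u < t, S u ω ∈ A} := by
  have : {ω | S t ω = x ∧ ∀ u < t, S u ω ∈ A}
      = S t ⁻¹' {x} ∩ ⋂ u, ⋂ (_ : u < t), S u ⁻¹' A := by
    ext ω
    simp
  rw [this]
  exact (hS t (measurableSet_singleton x)).inter (MeasurableSet.iInter fun u =>
    MeasurableSet.iInter fun _ => hS u MeasurableSet.of_discrete)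

lemma measurableSet_exitEvent (hS : ∀ t, Measurable (S t)) (A : Set (Site m)) (x : Site m) :
    MeasurableSet (exitEvent S A x) := by
  by_cases hx : x ∈ A
  · simp [exitEvent, hx]
  · rw [exitEvent_eq_iUnion hx]
    exact MeasurableSet.iUnion fun t => measurableSet_walk hS A t x

lemma measure_exitEvent [IsProbabilityMeasure μ] (hS : IsSimpleRandomWalk μ z S)
    (A : Set (Site m)) (x : Site m) : μ (exitEvent S A x) = exitDist A z x := by
  by_cases hx : x ∈ A
  · simp [exitEvent, hx, exitDist_of_mem]
  · rw [exitDist_of_notMem hx, exitEvent_eq_iUnion hx, measure_iUnion]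
    · exact tsum_congr fun t => measure_killedWalk hS A t x
    · intro t u htu
      refine Set.disjoint_left.2 fun ω h1 h2 => htu ?_
      exact exit_time_unique (s := fun t => S t ω) (h1.1.symm ▸ hx) h1.2 (h2.1.symm ▸ hx) h2.2
    · exact fun t => measurableSet_walk hS.measurable A t x

/-- Sending one particle to a finite set. -/
lemma lintegral_addParticle [IsProbabilityMeasure μ] {z : Fin m → ℤ}
    (hS : IsSimpleRandomWalk μ (sourceSite z) S) {A : Set (Site m)} (hA : A.Finite)
    (f : Set (Site m) → ℝ≥0∞) :
    ∫⁻ ω, f (addParticle A fun t => S t ω) ∂μ = send (sourceSite z) f A := by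
  have hm := measurableSet_exitEvent hS.measurable A
  have hd := disjoint_exitEvent S A
  have h1 : μ (⋃ x, exitEvent S A x) = 1 := by
    rw [measure_iUnion hd hm]
    simp only [measure_exitEvent hS, tsum_exitDist hA]
  have hae : (⋃ x, exitEvent S A x : Set Ω) =ᵐ[μ] Set.univ := by
    rw [ae_eq_univ, prob_compl_eq_zero_iff (MeasurableSet.iUnion hm), h1]
  -- The integrand is constant on each of countably many exit events, so no measurability of `f` is
  -- needed.
  rw [← setLIntegral_univ, ← setLIntegral_congr hae, lintegral_iUnion hm hd, send]
  refine tsum_congr fun x => ?_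
  rw [setLIntegral_congr_fun (hm x) (g := fun _ => f (insert x A))
    fun ω hω => by rw [addParticle_of_mem_exitEvent hω], setLIntegral_const,
    measure_exitEvent hS, mul_comm]

end walk

/-! ### Measurability in the random set -/

section measurability
variable {α : Type*} {mα : MeasurableSpace α} {m : ℕ}

lemma measurable_addParticle {A : α → Set (Site m)} {s : α → ℕ → Site m} (hA : Measurable A)
    (hs : ∀ t, Measurable fun a => s a t) : Measurable fun a => addParticle (A a) (s a) := by
  have hA' : ∀ x, MeasurableSet {a | x ∈ A a} := fun x =>
    measurableSet_setOfPred.2 (measurable_set_iff.1 hA x)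
  have hsA : ∀ u, MeasurableSet {a | s a u ∈ A a} := by
    intro u
    have : {a | s a u ∈ A a} = ⋃ x, ((fun a => s a u) ⁻¹' {x} ∩ {a | x ∈ A a}) := by
      ext a
      simp
    rw [this]
    exact MeasurableSet.iUnion fun x => (hs u (measurableSet_singleton x)).inter (hA' x)
  refine measurable_set_iff.2 fun x => measurableSet_setOfPred.1 ?_
  have : {a | x ∈ addParticle (A a) (s a)} = {a | x ∈ A a} ∪ ⋃ t, ((fun a => s a t) ⁻¹' {x} ∩
      ({a | x ∈ A a}ᶜ ∩ ⋂ u, ⋂ (_ : u < t), {a | s a u ∈ A a})) := by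
    ext a
    simp [addParticle]
  rw [this]
  exact (hA' x).union (MeasurableSet.iUnion fun t => (hs t (measurableSet_singleton x)).inter
    ((hA' x).compl.inter (MeasurableSet.iInter fun u => MeasurableSet.iInter fun _ => hsA u)))

/-- The σ-algebra on `α` is left free so that it can be the one generated by the paths of `L` alone.
-/
lemma measurable_foldl_addParticle {κ : Type*} (s : κ → α → ℕ → Site m) (L : List κ)
    (hs : ∀ p ∈ L, ∀ t, Measurable fun a => s p a t) {A : α → Set (Site m)}
    (hA : Measurable A) :
    Measurable fun a => L.foldl (fun B p => addParticle B (s p a)) (A a) := by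
  induction L generalizing A with
  | nil => exact hA
  | cons p L ih =>
    exact ih (fun q hq => hs q (List.mem_cons_of_mem _ hq))
      (measurable_addParticle hA (hs p List.mem_cons_self))

lemma finite_addParticle {A : Set (Site m)} (hA : A.Finite) (s : ℕ → Site m) :
    (addParticle A s).Finite := by
  refine hA.union (Set.Subsingleton.finite ?_)
  rintro _ ⟨t, rfl, hx, ht⟩ _ ⟨u, rfl, hy, hu⟩
  rw [exit_time_unique hx ht hy hu]

lemma finite_foldl_addParticle {κ : Type*} (s : κ → ℕ → Site m) (L : List κ)
    {A : Set (Site m)} (hA : A.Finite) :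
    (L.foldl (fun B p => addParticle B (s p)) A).Finite := by
  induction L generalizing A with
  | nil => exact hA
  | cons p L ih => exact ih (finite_addParticle hA _)

lemma measurable_indicator_set {f : Set (Site m) → ℝ≥0∞} (hf : Measurable f) (x : Site m) :
    Measurable fun A : Set (Site m) => A.indicator (fun _ => f A) x := by
  classical
  simp only [Set.indicator_apply]
  exact Measurable.ite (measurableSet_setOfPred.2 (measurable_set_mem x)) hf measurable_const

lemma measurable_killedWalk (z : Site m) (t : ℕ) (x : Site m) :
    Measurable fun A => killedWalk A z t x := by
  induction t generalizing x with
  | zero => exact measurable_const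
  | succ t ih =>
    simp only [killedWalk_succ, nbrAvg]
    refine Measurable.const_mul (Finset.measurable_fun_sum _ fun j _ => Measurable.add ?_ ?_) _
    · exact measurable_indicator_set (ih _) _
    · exact measurable_indicator_set (ih _) _

lemma measurable_exitDist (z x : Site m) : Measurable fun A => exitDist A z x := by
  classical
  refine Measurable.tsum fun t => ?_
  simp only [Set.indicator_apply]
  exact Measurable.ite (measurableSet_setOfPred.2 (measurable_set_mem x)).compl
    (measurable_killedWalk z t x) measurable_const

/-- Keeps the test function measurable when particles are integrated out one by one. -/
lemma measurable_send {f : Set (Site m) → ℝ≥0∞} (hf : Measurable f) (z : Site m) :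
    Measurable (send z f) := by
  refine Measurable.tsum fun x => (measurable_exitDist z x).mul (hf.comp ?_)
  exact measurable_set_iff.2 fun y => by
    simpa only [Set.mem_insert_iff] using measurable_const.or (measurable_set_mem y)

lemma measurable_mass (w : Site m → ℝ≥0∞) : Measurable (mass w) :=
  Measurable.tsum fun x => measurable_indicator_set (f := fun _ => w x) measurable_const x

end measurability

/-! ### Expectations for the aggregates and passage to the limit -/

section aggregate
variable {Ω : Type*} [MeasurableSpace Ω] {μ : Measure Ω} [IsProbabilityMeasure μ] {m n : ℕ}
  {S : (Fin m → ℤ) → Fin n → ℕ → Ω → Site m}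

/-- The expectation of a function of the aggregate produced by a list of distinct particles. -/
lemma lintegral_foldl_addParticle
    (hS : ∀ (z : Fin m → ℤ) (i : Fin n), IsSimpleRandomWalk μ (sourceSite z) (S z i))
    (hindep : iIndepFun
      (fun (p : (Fin m → ℤ) × Fin n) (ω : Ω) (t : ℕ) => S p.1 p.2 t ω) μ)
    {L : List ((Fin m → ℤ) × Fin n)} (hL : L.Nodup) {f : Set (Site m) → ℝ≥0∞}
    (hf : Measurable f) :
    ∫⁻ ω, f (L.foldl (fun B p => addParticle B fun t => S p.1 p.2 t ω) ∅) ∂μ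
      = ((L.map Prod.fst).map sourceSite).foldr send f ∅ := by
  induction L using List.reverseRecOn generalizing f with
  | nil => simp
  | append_singleton L p ih =>
    have hpL : p ∉ L := fun h => by
      have := List.nodup_append.1 hL
      exact this.2.2 p h p (by simp) rfl
    set path : (Fin m → ℤ) × Fin n → Ω → ℕ → Site m := fun p ω t => S p.1 p.2 t ω with hpath
    have hpm : ∀ p, Measurable (path p) := fun p =>
      measurable_pi_iff.2 fun t => (hS p.1 p.2).measurable t
    set X : Ω → Set (Site m) := fun ω => L.foldl (fun B p => addParticle B (path p ω)) ∅ with hX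
    have hXm : Measurable X := measurable_foldl_addParticle path L
      (fun p _ t => (hS p.1 p.2).measurable t) measurable_const
    -- The earlier aggregate depends only on paths other than that of `p`; this is where
    -- distinctness of the particles is used.
    have hXpast : Measurable[⨆ q ∈ {q | q ∈ L}, MeasurableSpace.comap (path q) inferInstance] X :=
      measurable_foldl_addParticle path L (fun q hq t => by
        refine (measurable_pi_apply t).comp (Measurable.mono (comap_measurable (path q)) ?_ le_rfl)
        exact le_iSup₂_of_le q hq le_rfl) measurable_const
    have hind : IndepFun X (path p) μ := by
      have := indep_iSup_of_disjoint (fun q => (hpm q).comap_le) hindep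
        (S := {q | q ∈ L}) (T := {p}) (by simpa using hpL)
      rw [IndepFun_iff_Indep]
      refine indep_of_indep_of_le_left (m₁ := _) ?_ hXpast.comap_le
      simpa using this
    have hg : Measurable fun q : Set (Site m) × (ℕ → Site m) => f (addParticle q.1 q.2) :=
      hf.comp (measurable_addParticle measurable_fst fun t =>
        (measurable_pi_apply t).comp measurable_snd)
    simp only [List.foldl_append, List.foldl_cons, List.foldl_nil, List.map_append,
      List.foldr_append, List.map_cons, List.map_nil, List.foldr_cons, List.foldr_nil]
    rw [← ih hL.of_append_left (measurable_send hf _)]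
    change ∫⁻ ω, f (addParticle (X ω) (path p ω)) ∂μ = ∫⁻ ω, send (sourceSite p.1) f (X ω) ∂μ
    have h1 := lintegral_map hg (hXm.prodMk (hpm p)) (μ := μ)
    rw [← h1, (indepFun_iff_map_prod_eq_prod_map_map hXm.aemeasurable (hpm p).aemeasurable).1 hind,
      lintegral_prod _ hg.aemeasurable, lintegral_map hg.lintegral_prod_right' hXm]
    refine lintegral_congr fun ω => ?_
    refine (lintegral_map (hg.comp (measurable_prodMk_left (x := X ω))) (hpm p)).trans ?_
    exact lintegral_addParticle (hS p.1 p.2) (finite_foldl_addParticle _ L Set.finite_empty) f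

lemma aggregate_eq_foldl (s : (Fin m → ℤ) → Fin n → ℕ → Site m) (M : ℕ) :
    aggregate s M = (particlesUpTo m n M).foldl (fun B p => addParticle B (s p.1 p.2)) ∅ := by
  induction M with
  | zero => simp [aggregate, sendLevel, particlesUpTo]
  | succ M ih =>
    rw [aggregate, ih, sendLevel, particlesUpTo, particlesUpTo, List.range_succ (n := M + 1),
      List.flatMap_append, List.foldl_append]
    simp

lemma monotone_aggregate (s : (Fin m → ℤ) → Fin n → ℕ → Site m) : Monotone (aggregate s) := by
  have h : ∀ (L : List ((Fin m → ℤ) × Fin n)) (A : Set (Site m)),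
      A ⊆ L.foldl (fun B p => addParticle B (s p.1 p.2)) A := by
    intro L
    induction L with
    | nil => exact fun A => le_rfl
    | cons p L ih => exact fun A => Set.subset_union_left.trans (ih _)
  exact monotone_nat_of_le_succ fun M => h _ _

/-- Monotone convergence for the counting measure. -/
lemma mass_iUnion (w : Site m → ℝ≥0∞) {A : ℕ → Set (Site m)} (hA : Monotone A) :
    mass w (⋃ M, A M) = ⨆ M, mass w (A M) := by
  have h : ∀ B, mass w B = ∫⁻ x, B.indicator w x ∂Measure.count := fun B => by
    rw [lintegral_count]; rfl
  simp only [h]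
  rw [← lintegral_iSup (fun M => Measurable.of_discrete)
    fun M N hMN x => Set.indicator_le_indicator_of_subset (hA hMN) (fun _ => zero_le) x]
  congr 1
  funext x
  exact Set.indicator_iUnion_apply rfl A w x

end aggregate

theorem mainTheorem4 {Ω : Type*} [MeasurableSpace Ω] (μ : Measure Ω) [IsProbabilityMeasure μ]
    (m n : ℕ) (hm : 2 ≤ m) (hn : 1 ≤ n)
    (S : (Fin m → ℤ) → Fin n → ℕ → Ω → Site m)
    (hS : ∀ (z : Fin m → ℤ) (i : Fin n), IsSimpleRandomWalk μ (sourceSite z) (S z i))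
    (hindep : iIndepFun
      (fun (p : (Fin m → ℤ) × Fin n) (ω : Ω) (t : ℕ) => S p.1 p.2 t ω) μ)
    (y : Fin m → ℤ) :
    Measurable (fun ω : Ω =>
      ((limitAggregate (fun z i t => S z i t ω) ∩ line y).encard : ℝ≥0∞)) ∧
    ∫⁻ ω, ((limitAggregate (fun z i t => S z i t ω) ∩ line y).encard : ℝ≥0∞) ∂μ
      = (n : ℝ≥0∞) := by
  have hmeas : ∀ M, Measurable fun ω =>
      mass (lineWeight y) (aggregate (fun z i t => S z i t ω) M) := by
    intro M
    simp only [aggregate_eq_foldl]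
    exact (measurable_mass _).comp (measurable_foldl_addParticle
      (fun (p : (Fin m → ℤ) × Fin n) ω t => S p.1 p.2 t ω) _
      (fun p _ t => (hS p.1 p.2).measurable t) measurable_const)
  have hlim : ∀ ω, ((limitAggregate (fun z i t => S z i t ω) ∩ line y).encard : ℝ≥0∞)
      = ⨆ M, mass (lineWeight y) (aggregate (fun z i t => S z i t ω) M) := by
    intro ω
    rw [← mass_lineWeight, limitAggregate, mass_iUnion _ (monotone_aggregate _)]
  simp only [hlim]
  refine ⟨Measurable.iSup hmeas, ?_⟩
  -- Monotone convergence again, now over `Ω`, reduces the claim to the finite aggregates.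
  rw [lintegral_iSup hmeas fun M N hMN ω => ?_]
  · rw [← iSup_expMass_particlesUpTo m n y]
    congr 1
    funext M
    simp only [aggregate_eq_foldl]
    exact lintegral_foldl_addParticle hS hindep (nodup_particlesUpTo m n M) (measurable_mass _)
  · exact ENNReal.tsum_le_tsum fun x => Set.indicator_le_indicator_of_subset
      (monotone_aggregate _ hMN) (fun _ => zero_le) x
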